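/- Let $n\ge 5$, let $V$ be an $n$-dimensional real vector space (a tangent space $T_p(M)$) with a Lorentzian inner product $g$ of signature $(-+\cdots+)$, and let $R_{ab}$ be a real symmetric two-tensor on $V$, with mixed form $R^a{}_b=g^{ac}R_{cb}$, regarded as a linear operator $V\to V$. The Segre type of $R^a{}_b$ lists the dimensions of the Jordan blocks of its Jordan canonical form over $\mathbb{C}$, the entries belonging to one and the same eigenvalue being grouped by round brackets; a digit $1$ belonging to a time-like eigenvector is marked by a comma after it, and for a non-real eigenvalue the digit is replaced by a letter $z$ or $\bar z$ (according to the sign of the imaginary part). A degeneracy of a Segre type arises from it by putting round brackets around some of its entries (coincidences among the eigenvalues); below, "or a degeneracy" includes the type without brackets. A semi-null basis is a basis $\{l,m,x^{(1)},\dots,x^{(n-2)}\}$ of $V$ whose only non-vanishing inner products are $l\cdot m=x^{(1)}\cdot x^{(1)}=\cdots=x^{(n-2)}\cdot x^{(n-2)}=1$. Indices are lowered with $g$, and $u_{(a}v_{b)}=\tfrac12(u_av_b+v_au_b)$. Then: 1. $R^a{}_b$ has a real space-like eigenvector (with real eigenvalue). 2. The Segre type of $R^a{}_b$ is $[1,1\ldots1]$,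 $[21\ldots1]$, $[31\ldots1]$ or $[z\,\bar z\,1\ldots1]$, or a degeneracy of one of these. 3. For each of these four types, $R^a{}_b$ has that Segre type or a degeneracy of it if and only if there are a semi-null basis and real numbers $\rho_1,\dots,\rho_n$ (those that occur) with respect to which $R_{ab}$ has the corresponding canonical form: $$\begin{aligned} {}[1,1\ldots1]:\quad R_{ab}&=2\rho_1 l_{(a}m_{b)}+\rho_2(l_al_b+m_am_b)+\rho_3x^{(1)}_ax^{(1)}_b+\rho_4x^{(2)}_ax^{(2)}_b+\cdots+\rho_nx^{(n-2)}_ax^{(n-2)}_b,\\ [21\ldots1]:\quad R_{ab}&=2\rho_1 l_{(a}m_{b)}\pm l_al_b+\rho_3x^{(1)}_ax^{(1)}_b+\rho_4x^{(2)}_ax^{(2)}_b+\cdots+\rho_nx^{(n-2)}_ax^{(n-2)}_b,\\ [31\ldots1]:\quad R_{ab}&=2\rho_1 l_{(a}m_{b)}+2l_{(a}x^{(1)}_{b)}+\rho_1x^{(1)}_ax^{(1)}_b+\rho_4x^{(2)}_ax^{(2)}_b+\cdots+\rho_nx^{(n-2)}_ax^{(n-2)}_b,\\ [z\,\bar z\,1\ldots1]:\quad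 R_{ab}&=2\rho_1 l_{(a}m_{b)}+\rho_2(l_al_b-m_am_b)+\rho_3x^{(1)}_ax^{(1)}_b+\rho_4x^{(2)}_ax^{(2)}_b+\cdots+\rho_nx^{(n-2)}_ax^{(n-2)}_b,\quad\rho_2\neq0. \end{aligned}$$ -/

import Mathlib

open scoped TensorProduct

namespace SegreClassification

variable {V : Type*} [AddCommGroup V] [Module ℝ V]

/-! ## Lorentzian spaces and mixed tensors -/

/-- `g` is a Lorentzian inner product of signature `(- + ⋯ +)` on the `n`-dimensional space `V`:
it has a Lorentz basis `e₀, …, e_{n-1}`, i.e. a basis whose only non-zero inner products are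
`-e₀ ⬝ e₀ = e₁ ⬝ e₁ = ⋯ = e_{n-1} ⬝ e_{n-1} = 1`. -/
def IsLorentzian (n : ℕ) (g : LinearMap.BilinForm ℝ V) : Prop :=
  ∃ e : Module.Basis (Fin n) ℝ V, ∀ i j,
    g (e i) (e j) = if i = j then (if i.val = 0 then -1 else 1) else 0

theorem IsLorentzian.nondegenerate {n : ℕ} {g : LinearMap.BilinForm ℝ V}
    (hg : IsLorentzian n g) : g.Nondegenerate := by
  obtain ⟨e, he⟩ := hg
  have h : g.iIsOrtho e := by
    intro i j hij
    change g (e i) (e j) = 0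
    rw [he, if_neg hij]
  refine h.nondegenerate_of_not_isOrtho_basis_self e ?_
  intro i hi
  have h0 : g (e i) (e i) = 0 := hi
  rw [he, if_pos rfl] at h0
  split_ifs at h0 <;> norm_num at h0

/-- The mixed form `R^a_b = g^{ac} R_{cb}` of a two-tensor `R_{ab}`, as a linear operator:
the operator `T` with `g (T v) w = R v w` for all `v`, `w`. -/
noncomputable def mixed [FiniteDimensional ℝ V] (g : LinearMap.BilinForm ℝ V)
    (hg : g.Nondegenerate) (R : LinearMap.BilinForm ℝ V) : Module.End ℝ V :=
  R.symmCompOfNondegenerate g hg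

/-- The covariant two-tensor `u_a v_b`, indices being lowered with `g`. -/
noncomputable def dyad (g : LinearMap.BilinForm ℝ V) (u v : V) : LinearMap.BilinForm ℝ V :=
  LinearMap.BilinForm.linMulLin (g u) (g v)

/-- The symmetrised two-tensor `u_{(a} v_{b)} = (u_a v_b + v_a u_b) / 2`. -/
noncomputable def symDyad (g : LinearMap.BilinForm ℝ V) (u v : V) : LinearMap.BilinForm ℝ V :=
  (1 / 2 : ℝ) • (dyad g u v + dyad g v u)

/-- A semi-null basis `{l, m, x⁽¹⁾, …, x⁽ᵏ⁾}`: a basis whose only non-vanishing inner products are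
`l ⬝ m = x⁽¹⁾ ⬝ x⁽¹⁾ = ⋯ = x⁽ᵏ⁾ ⬝ x⁽ᵏ⁾ = 1`. Here `x i` is `x⁽ⁱ⁺¹⁾`. -/
structure SemiNullBasis (g : LinearMap.BilinForm ℝ V) (k : ℕ) where
  l : V
  m : V
  x : Fin k → V
  linearIndependent : LinearIndependent ℝ (Sum.elim ![l, m] x)
  span_eq_top : Submodule.span ℝ (Set.range (Sum.elim ![l, m] x)) = ⊤
  l_l : g l l = 0
  m_m : g m m = 0
  l_m : g l m = 1
  m_l : g m l = 1
  l_x : ∀ i, g l (x i) = 0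
  x_l : ∀ i, g (x i) l = 0
  m_x : ∀ i, g m (x i) = 0
  x_m : ∀ i, g (x i) m = 0
  x_x : ∀ i j, g (x i) (x j) = if i = j then 1 else 0

/-! ## Segre types -/

/-- The Jordan block `J_r(μ)`. -/
def jordanBlock (r : ℕ) (μ : ℂ) : Matrix (Fin r) (Fin r) ℂ :=
  Matrix.of fun i j => if i = j then μ else if i.val + 1 = j.val then 1 else 0

/-- In some basis of the complexification of `V`, the complexification of `T` has as its matrix a
Jordan canonical form with blocks `J_{r 0}(μ 0), …, J_{r (N-1)}(μ (N-1))`, each of them of positive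
dimension. -/
def HasJordanForm (T : Module.End ℝ V) {N : ℕ} (r : Fin N → ℕ) (μ : Fin N → ℂ) : Prop :=
  (∀ k, 0 < r k) ∧
    ∃ b : Module.Basis (Σ k, Fin (r k)) ℂ (ℂ ⊗[ℝ] V),
      LinearMap.toMatrix b b (T.baseChange ℂ) =
        Matrix.blockDiagonal' fun k => jordanBlock (r k) (μ k)

/-- The entries of a Segre symbol, one for each Jordan block: `digit r` is the digit `r` of an
`r`-dimensional block with real eigenvalue, `timelike` is the digit `1` that belongs to a time-like
eigenvector and is separated from the others by a comma, and `z r`, `zbar r` are the letters `z`,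
`z̄` that replace the digit `r` for an eigenvalue with positive, negative imaginary part. (One
writes just `z`, `z̄` for `z 1`, `zbar 1`.) -/
inductive SegreEntry : Type
  | timelike : SegreEntry
  | digit (r : ℕ) : SegreEntry
  | z (r : ℕ) : SegreEntry
  | zbar (r : ℕ) : SegreEntry

/-- A Segre type is an unordered list of unordered lists of entries: the inner lists are the groups
of entries that belong to the same eigenvalue (groups of several entries are the ones printed in
round brackets). For example, `[(1,1)1]` is `{{timelike, digit 1}, {digit 1}}` and `[(21)1]` is
`{{digit 2, digit 1}, {digit 1}}`. -/
abbrev SegreType : Type := Multiset (Multiset SegreEntry)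

open Classical in
/-- The group of entries belonging to the eigenvalue `ν` of `T`, where `d` is the multiset of the
dimensions of the Jordan blocks with eigenvalue `ν`. -/
noncomputable def segreGroup (g : LinearMap.BilinForm ℝ V) (T : Module.End ℝ V) (ν : ℂ)
    (d : Multiset ℕ) : Multiset SegreEntry :=
  if 0 < ν.im then d.map SegreEntry.z
  else if ν.im < 0 then d.map SegreEntry.zbar
  else if ∃ v : V, g v v < 0 ∧ T v = ν.re • v then
    SegreEntry.timelike ::ₘ (d.erase 1).map SegreEntry.digit
  else d.map SegreEntry.digit

open Classical in
/-- The operator `T` on the Lorentzian space `(V, g)` is of Segre type `σ`. -/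
def HasSegreType (g : LinearMap.BilinForm ℝ V) (T : Module.End ℝ V) (σ : SegreType) : Prop :=
  ∃ (N : ℕ) (r : Fin N → ℕ) (μ : Fin N → ℂ), HasJordanForm T r μ ∧
    σ = (Finset.univ.image μ).val.map fun ν =>
      segreGroup g T ν ((Finset.univ.filter fun k => μ k = ν).val.map r)

/-- `σ` is `[τ]`, or a degeneracy of it: the entries of `σ` are those of `τ`, with round brackets
put around some of them. -/
def IsDegeneracyOf (σ : SegreType) (τ : Multiset SegreEntry) : Prop :=
  σ.join = τ ∧ 0 ∉ σ

/-- The four classes of symmetric two-tensors. -/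
inductive SegreClass : Type
  /-- `[1,1…1]` -/
  | one : SegreClass
  /-- `[21…1]` -/
  | two : SegreClass
  /-- `[31…1]` -/
  | three : SegreClass
  /-- `[z z̄ 1…1]` -/
  | complex : SegreClass

/-- The non-degenerate Segre types `[1,1…1]`, `[21…1]`, `[31…1]` and `[z z̄ 1…1]` in dimension
`n`. -/
def SegreClass.entries (n : ℕ) : SegreClass → Multiset SegreEntry
  | .one => SegreEntry.timelike ::ₘ Multiset.replicate (n - 1) (SegreEntry.digit 1)
  | .two => SegreEntry.digit 2 ::ₘ Multiset.replicate (n - 2) (SegreEntry.digit 1)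
  | .three => SegreEntry.digit 3 ::ₘ Multiset.replicate (n - 3) (SegreEntry.digit 1)
  | .complex =>
      SegreEntry.z 1 ::ₘ SegreEntry.zbar 1 ::ₘ Multiset.replicate (n - 2) (SegreEntry.digit 1)

/-! ## Canonical forms -/

/-- With respect to the semi-null basis `B`, the tensor `R_{ab}` has the canonical form that goes
with the given class. Here `ρ i` is the coefficient `ρ_{i+3}` of `x⁽ⁱ⁺¹⁾ₐ x⁽ⁱ⁺¹⁾_b`. In the third
form, which needs `x⁽¹⁾`, the coefficient of `x⁽¹⁾ₐ x⁽¹⁾_b` is `ρ₁`. -/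
def CanonicalForm {g : LinearMap.BilinForm ℝ V} {k : ℕ} (B : SemiNullBasis g k)
    (R : LinearMap.BilinForm ℝ V) : SegreClass → Prop
  | .one => ∃ (ρ₁ ρ₂ : ℝ) (ρ : Fin k → ℝ),
      R = (2 * ρ₁) • symDyad g B.l B.m + ρ₂ • (dyad g B.l B.l + dyad g B.m B.m)
        + ∑ i, ρ i • dyad g (B.x i) (B.x i)
  | .two => ∃ (ρ₁ ε : ℝ) (ρ : Fin k → ℝ), (ε = 1 ∨ ε = -1) ∧
      R = (2 * ρ₁) • symDyad g B.l B.m + ε • dyad g B.l B.l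
        + ∑ i, ρ i • dyad g (B.x i) (B.x i)
  | .three => ∃ (ρ₁ : ℝ) (ρ : Fin k → ℝ) (i₁ : Fin k), i₁.val = 0 ∧ ρ i₁ = ρ₁ ∧
      R = (2 * ρ₁) • symDyad g B.l B.m + (2 : ℝ) • symDyad g B.l (B.x i₁)
        + ∑ i, ρ i • dyad g (B.x i) (B.x i)
  | .complex => ∃ (ρ₁ ρ₂ : ℝ) (ρ : Fin k → ℝ), ρ₂ ≠ 0 ∧
      R = (2 * ρ₁) • symDyad g B.l B.m + ρ₂ • (dyad g B.l B.l - dyad g B.m B.m)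
        + ∑ i, ρ i • dyad g (B.x i) (B.x i)

end SegreClassification

namespace SegreClassification

variable {V : Type*} [AddCommGroup V] [Module ℝ V]

/-! ## Lorentzian geometry -/

section Lorentz

variable {g : LinearMap.BilinForm ℝ V}

/-! The mixed operator `T` is self-adjoint for `g`, so an invariant subspace has an invariant
orthogonal complement. Once an invariant subspace containing a time-like vector is brought to normal
form, `g` is positive definite on its complement and the spectral theorem diagonalises `T` there
(`exists_orthonormal_eigenvectors_orthogonal`).

To find such a subspace, split a time-like vector into its primary components. They are mutually
orthogonal, so one of them is time-like. If its irreducible polynomial is quadratic, there is an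
invariant plane with non-real eigenvalues. If it is linear, with root `a`, put `N = T - a`: either
the vector is an eigenvector, or some chain `z, N z, …, N ^ p z` ends with `N ^ (p + 1) z = 0` and
pairs its two ends non-trivially. Orthogonal null vectors are proportional in Lorentzian signature,
which forces `p ≤ 2`. These alternatives are the four classes, so every `T` has some canonical form
(`exists_canonicalAction`).

Conversely, each canonical form exhibits an explicit Jordan basis, hence the Segre type of its
class. The classes exclude each other (`SegreClass.eq_of_hasSegreType`): a time-like eigenvector, a
non-real eigenvalue and a chain of length three each single out one class, and the remaining class
has none of them. So an operator whose Segre type lies in class `c` has a canonical form of some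
class, which must be `c`. Uniqueness of Jordan forms is not needed. In every canonical form the
vector `x⁽²⁾` is a space-like eigenvector. -/

theorem IsLorentzian.finrank {n : ℕ} (hg : IsLorentzian n g) : Module.finrank ℝ V = n := by
  obtain ⟨e, -⟩ := hg
  simpa using Module.finrank_eq_card_basis e

theorem IsLorentzian.apply_comm {n : ℕ} (hg : IsLorentzian n g) (u v : V) : g u v = g v u := by
  obtain ⟨e, he⟩ := hg
  have h : g = g.flip := e.ext fun i => e.ext fun j => by
    rw [LinearMap.BilinForm.flip_apply, he, he]
    by_cases hij : i = j
    · subst hij; rfl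
    · rw [if_neg hij, if_neg (Ne.symm hij)]
  calc g u v = g.flip u v := by rw [← h]
    _ = g v u := LinearMap.BilinForm.flip_apply ..

/-- `g` is positive definite on some hyperplane. -/
def PosOnHyperplane (g : LinearMap.BilinForm ℝ V) : Prop :=
  ∃ φ : V →ₗ[ℝ] ℝ, ∀ u, φ u = 0 → u ≠ 0 → 0 < g u u

theorem IsLorentzian.posOnHyperplane {n : ℕ} (hn : 0 < n) (hg : IsLorentzian n g) :
    PosOnHyperplane g := by
  obtain ⟨e, he⟩ := hg
  obtain ⟨m, rfl⟩ : ∃ m, n = m + 1 := ⟨n - 1, by omega⟩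
  refine ⟨e.coord 0, fun u hu hu0 => ?_⟩
  have key : g u u = ∑ i, e.repr u i * e.repr u i := by
    conv_lhs => rw [← e.sum_repr u]
    simp only [map_sum, LinearMap.sum_apply, map_smul, LinearMap.smul_apply, he, smul_eq_mul]
    refine Finset.sum_congr rfl fun i _ => ?_
    rw [Finset.sum_eq_single i]
    · by_cases hi : i.val = 0
      · have : i = 0 := Fin.ext hi
        subst this
        have : e.repr u 0 = 0 := hu
        simp [this]
      · simp [hi]
    · intro j _ hj
      simp [hj]
    · simp
  rw [key]
  obtain ⟨i, hi⟩ : ∃ i, e.repr u i ≠ 0 := by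
    by_contra! h
    exact hu0 (e.repr.map_eq_zero_iff.1 (Finsupp.ext h))
  exact Finset.sum_pos' (fun j _ => mul_self_nonneg _) ⟨i, Finset.mem_univ _, mul_self_pos.2 hi⟩

theorem IsLorentzian.exists_timelike {n : ℕ} (hn : 0 < n) (hg : IsLorentzian n g) :
    ∃ v, g v v < 0 := by
  obtain ⟨e, he⟩ := hg
  exact ⟨e ⟨0, hn⟩, by rw [he]; simp⟩

/-- The combination `φ w • v - φ v • w` lies in the hyperplane, yet by orthogonality its square is
at most zero, so it vanishes. If `φ v = 0`, already `v = 0`. -/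
theorem PosOnHyperplane.dependent (hp : PosOnHyperplane g) (hs : ∀ u v, g u v = g v u) {v w : V}
    (hv : g v v ≤ 0) (hw : g w w ≤ 0) (hvw : g v w = 0) :
    ∃ s t : ℝ, (s ≠ 0 ∨ t ≠ 0) ∧ s • v + t • w = 0 := by
  obtain ⟨φ, hφ⟩ := hp
  by_cases h : φ v = 0
  · refine ⟨1, 0, Or.inl one_ne_zero, ?_⟩
    by_contra h0
    have := hφ v h (by simpa using h0)
    linarith
  · refine ⟨φ w, -φ v, Or.inr (neg_ne_zero.2 h), ?_⟩
    by_contra h0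
    have := hφ _ (by simp; ring) h0
    have e : g (φ w • v + -φ v • w) (φ w • v + -φ v • w)
        = φ w ^ 2 * g v v + φ v ^ 2 * g w w := by
      simp [hs w v, hvw]; ring
    nlinarith [mul_nonneg (sq_nonneg (φ w)) (neg_nonneg.2 hv),
      mul_nonneg (sq_nonneg (φ v)) (neg_nonneg.2 hw)]

theorem PosOnHyperplane.pos_of_orthogonal_timelike (hp : PosOnHyperplane g)
    (hs : ∀ u v, g u v = g v u) {v w : V} (hv : g v v < 0) (hvw : g v w = 0) (hw : w ≠ 0) :
    0 < g w w := by
  by_contra! h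
  obtain ⟨s, t, hst, h0⟩ := hp.dependent hs hv.le h hvw
  have h1 : s * g v v = 0 := by
    have := congrArg (g v) h0
    simpa [hvw] using this
  have hs0 : s = 0 := by simpa [hv.ne] using h1
  subst hs0
  simp_all

/-- Two orthogonal null vectors are proportional. -/
theorem PosOnHyperplane.proportional_of_null (hp : PosOnHyperplane g)
    (hs : ∀ u v, g u v = g v u) {v w : V} (hv : g v v = 0) (hw : g w w = 0) (hvw : g v w = 0)
    (hw0 : w ≠ 0) : ∃ c : ℝ, v = c • w := by
  obtain ⟨s, t, hst, h0⟩ := hp.dependent hs hv.le hw.le hvw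
  have hs0 : s ≠ 0 := by
    rintro rfl
    simp_all
  refine ⟨-(s⁻¹ * t), ?_⟩
  have := congrArg (s⁻¹ • ·) h0
  simp only [smul_add, smul_smul, inv_mul_cancel₀ hs0, one_smul, smul_zero] at this
  rw [neg_smul]
  exact eq_neg_of_add_eq_zero_left this

end Lorentz

/-! ## Diagonalisation on a positive definite complement -/

section Diagonalisation

/-- The spectral theorem for an operator that is self-adjoint with respect to a positive definite
bilinear form. -/
theorem exists_orthonormal_eigenvectors_of_posDef [FiniteDimensional ℝ V]
    (B : LinearMap.BilinForm ℝ V)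
    (hs : ∀ u v, B u v = B v u) (hpos : ∀ u, u ≠ 0 → 0 < B u u) (S : Module.End ℝ V)
    (hS : ∀ u v, B (S u) v = B u (S v)) {k : ℕ} (hk : Module.finrank ℝ V = k) :
    ∃ (y : Fin k → V) (ρ : Fin k → ℝ), (∀ i, S (y i) = ρ i • y i) ∧
      ∀ i j, B (y i) (y j) = if i = j then 1 else 0 := by
  let cd : InnerProductSpace.Core ℝ V :=
    { inner := fun u v => B u v
      conj_inner_symm := fun u v => by simpa using hs v u
      re_inner_nonneg := fun u => by
        by_cases hu : u = 0
        · simp [hu]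
        · simpa using (hpos u hu).le
      add_left := fun u v w => by simp
      smul_left := fun u v r => by simp
      definite := fun u hu => by
        by_contra h
        exact (hpos u h).ne' hu }
  let : NormedAddCommGroup V := cd.toNormedAddCommGroup
  let : InnerProductSpace ℝ V := InnerProductSpace.ofCore cd.toCore
  have hS' : S.IsSymmetric := fun u v => hS u v
  refine ⟨fun i => hS'.eigenvectorBasis hk i, hS'.eigenvalues hk,
    fun i => hS'.apply_eigenvectorBasis hk i, fun i j => ?_⟩
  exact orthonormal_iff_ite.1 (hS'.eigenvectorBasis hk).orthonormal i j

/-- Self-adjointness carries the invariance of the span of `d` over to its orthogonal complement,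
where the positive definite spectral theorem applies; nondegeneracy of `g` gives the complement
dimension `k`. -/
theorem exists_orthonormal_eigenvectors_orthogonal [FiniteDimensional ℝ V]
    {g : LinearMap.BilinForm ℝ V} (hnd : g.Nondegenerate) (hs : ∀ u v, g u v = g v u)
    {T : Module.End ℝ V} (hT : ∀ u v, g (T u) v = g u (T v)) {j k : ℕ} (d : Fin j → V)
    (hd : LinearIndependent ℝ d) (hinv : ∀ i, T (d i) ∈ Submodule.span ℝ (Set.range d))
    (hpos : ∀ w, (∀ i, g (d i) w = 0) → w ≠ 0 → 0 < g w w) (hjk : Module.finrank ℝ V = j + k) :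
    ∃ (y : Fin k → V) (ρ : Fin k → ℝ), (∀ i, T (y i) = ρ i • y i) ∧
      (∀ i i', g (d i) (y i') = 0) ∧ ∀ i i', g (y i) (y i') = if i = i' then 1 else 0 := by
  set D := Submodule.span ℝ (Set.range d) with hD
  have hmem' : ∀ w, w ∈ g.orthogonal D → ∀ i, g (d i) w = 0 := fun w hw i =>
    hw _ (Submodule.subset_span ⟨i, rfl⟩)
  have hTD : ∀ u ∈ D, T u ∈ D := by
    intro u hu
    induction hu using Submodule.span_induction with
    | mem x hx => obtain ⟨i, rfl⟩ := hx; exact hinv i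
    | zero => simp
    | add x y _ _ hx hy => rw [map_add]; exact D.add_mem hx hy
    | smul a x _ hx => rw [map_smul]; exact D.smul_mem a hx
  have hTU : ∀ u ∈ g.orthogonal D, T u ∈ g.orthogonal D := by
    intro u hu w hw
    change g w (T u) = 0
    rw [← hT]
    exact hu _ (hTD w hw)
  have hrank : Module.finrank ℝ (g.orthogonal D) = k := by
    have h1 := LinearMap.BilinForm.finrank_orthogonal hnd D
    have h2 : Module.finrank ℝ D = j := by
      rw [hD, finrank_span_eq_card hd, Fintype.card_fin]
    omega
  obtain ⟨y, ρ, h1, h2⟩ := exists_orthonormal_eigenvectors_of_posDef (g.restrict (g.orthogonal D))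
    (fun u v => hs u v)
    (fun u hu => hpos u (hmem' u u.2) (by simpa using hu)) (T.restrict hTU)
    (fun u v => hT u v) hrank
  refine ⟨fun i => y i, ρ, fun i => ?_, fun i i' => hmem' _ (y i').2 i, fun i i' => h2 i i'⟩
  exact congrArg Subtype.val (h1 i)

end Diagonalisation

/-! ## Semi-null bases and the action of the canonical forms -/

section SemiNull

variable {g : LinearMap.BilinForm ℝ V}

theorem linearIndependent_of_gram {k : ℕ} {l m : V} {x : Fin k → V} (ll : g l l = 0)
    (mm : g m m = 0) (lm : g l m = 1) (ml : g m l = 1) (lx : ∀ i, g l (x i) = 0)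
    (mx : ∀ i, g m (x i) = 0) (xl : ∀ i, g (x i) l = 0) (xm : ∀ i, g (x i) m = 0)
    (xx : ∀ i j, g (x i) (x j) = if i = j then 1 else 0) :
    LinearIndependent ℝ (Sum.elim ![l, m] x) := by
  rw [Fintype.linearIndependent_iff]
  intro c hc
  simp only [Fintype.sum_sum_type, Fin.sum_univ_two, Sum.elim_inl, Sum.elim_inr,
    Matrix.cons_val_zero, Matrix.cons_val_one] at hc
  have h0 : c (Sum.inl 0) = 0 := by
    have := congrArg (g m) hc
    simpa [mm, ml, mx] using this
  have h1 : c (Sum.inl 1) = 0 := by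
    have := congrArg (g l) hc
    simpa [ll, lm, lx] using this
  rintro (i | i)
  · fin_cases i
    · exact h0
    · exact h1
  · have := congrArg (g (x i)) hc
    simpa [xl, xm, xx] using this

/-- A semi-null basis from vectors with the right inner products. -/
def SemiNullBasis.ofGram (hs : ∀ u v, g u v = g v u) {k : ℕ} (hk : Module.finrank ℝ V = k + 2)
    (l m : V) (x : Fin k → V) (ll : g l l = 0) (mm : g m m = 0) (lm : g l m = 1)
    (lx : ∀ i, g l (x i) = 0) (mx : ∀ i, g m (x i) = 0)
    (xx : ∀ i j, g (x i) (x j) = if i = j then 1 else 0) : SemiNullBasis g k where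
  l := l
  m := m
  x := x
  linearIndependent := linearIndependent_of_gram ll mm lm ((hs m l).trans lm) lx mx
    (fun i => (hs _ _).trans (lx i)) (fun i => (hs _ _).trans (mx i)) xx
  span_eq_top := by
    have hli := linearIndependent_of_gram ll mm lm ((hs m l).trans lm) lx mx
      (fun i => (hs _ _).trans (lx i)) (fun i => (hs _ _).trans (mx i)) xx
    have : Nonempty (Fin 2 ⊕ Fin k) := ⟨Sum.inl 0⟩
    exact hli.span_eq_top_of_card_eq_finrank (by simp [hk, add_comm])
  l_l := ll
  m_m := mm
  l_m := lm
  m_l := (hs m l).trans lm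
  l_x := lx
  x_l i := (hs _ _).trans (lx i)
  m_x := mx
  x_m i := (hs _ _).trans (mx i)
  x_x := xx

variable [FiniteDimensional ℝ V]

@[simp]
theorem mixed_apply (hg : g.Nondegenerate) (R : LinearMap.BilinForm ℝ V) (v w : V) :
    g (mixed g hg R v) w = R v w :=
  LinearMap.BilinForm.symmCompOfNondegenerate_left_apply R hg w v

theorem ext_of_nondegenerate (hg : g.Nondegenerate) {u v : V} (h : ∀ w, g u w = g v w) :
    u = v :=
  (g.toDual hg).injective (LinearMap.ext h)

theorem mixed_eq_iff (hg : g.Nondegenerate) (R : LinearMap.BilinForm ℝ V) (u v : V) :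
    mixed g hg R u = v ↔ ∀ w, R u w = g v w :=
  ⟨fun h w => by rw [← mixed_apply hg, h], fun h => ext_of_nondegenerate hg fun w => by
    rw [mixed_apply, h]⟩

theorem mixed_selfAdjoint (hg : g.Nondegenerate) (hs : ∀ u v, g u v = g v u)
    {R : LinearMap.BilinForm ℝ V} (hR : R.IsSymm) (u v : V) :
    g (mixed g hg R u) v = g u (mixed g hg R v) := by
  rw [hs u, mixed_apply, mixed_apply]
  exact hR.eq u v

namespace SemiNullBasis

variable {k : ℕ} (B : SemiNullBasis g k)

theorem eq_iff_mixed (hg : g.Nondegenerate) (R R' : LinearMap.BilinForm ℝ V)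
    {a b : V} {c : Fin k → V}
    (ha : ∀ w, R' B.l w = g a w) (hb : ∀ w, R' B.m w = g b w)
    (hc : ∀ i w, R' (B.x i) w = g (c i) w) :
    R = R' ↔ mixed g hg R B.l = a ∧ mixed g hg R B.m = b ∧ ∀ i, mixed g hg R (B.x i) = c i := by
  simp only [mixed_eq_iff]
  constructor
  · rintro rfl
    exact ⟨ha, hb, hc⟩
  · rintro ⟨h1, h2, h3⟩
    refine LinearMap.ext_on_range B.span_eq_top ?_
    rintro (i | i)
    · fin_cases i
      · exact LinearMap.ext fun w => (h1 w).trans (ha w).symm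
      · exact LinearMap.ext fun w => (h2 w).trans (hb w).symm
    · exact LinearMap.ext fun w => (h3 i w).trans (hc i w).symm

/-- The operator `T` acts on the semi-null basis `B` as the canonical form of the given class
does. -/
def CanonicalAction (T : Module.End ℝ V) : SegreClass → Prop
  | .one => ∃ (ρ₁ ρ₂ : ℝ) (ρ : Fin k → ℝ), T B.l = ρ₁ • B.l + ρ₂ • B.m ∧
      T B.m = ρ₂ • B.l + ρ₁ • B.m ∧ ∀ i, T (B.x i) = ρ i • B.x i
  | .two => ∃ (ρ₁ ε : ℝ) (ρ : Fin k → ℝ), (ε = 1 ∨ ε = -1) ∧ T B.l = ρ₁ • B.l ∧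
      T B.m = ε • B.l + ρ₁ • B.m ∧ ∀ i, T (B.x i) = ρ i • B.x i
  | .three => ∃ (ρ₁ : ℝ) (ρ : Fin k → ℝ) (i₁ : Fin k), i₁.val = 0 ∧ ρ i₁ = ρ₁ ∧
      T B.l = ρ₁ • B.l ∧ T B.m = B.x i₁ + ρ₁ • B.m ∧
      ∀ i, T (B.x i) = (if i = i₁ then B.l else 0) + ρ i • B.x i
  | .complex => ∃ (ρ₁ ρ₂ : ℝ) (ρ : Fin k → ℝ), ρ₂ ≠ 0 ∧ T B.l = ρ₁ • B.l - ρ₂ • B.m ∧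
      T B.m = ρ₂ • B.l + ρ₁ • B.m ∧ ∀ i, T (B.x i) = ρ i • B.x i

/-- Among the basis vectors `l` pairs only with `m`, so the term `l_a l_b` shows up in `T m` and the
term `m_a m_b` in `T l`. -/
theorem canonicalForm_iff (hg : g.Nondegenerate) (R : LinearMap.BilinForm ℝ V) (c : SegreClass) :
    CanonicalForm B R c ↔ B.CanonicalAction (mixed g hg R) c := by
  have hx : ∀ (ρ : Fin k → ℝ) (j : Fin k) (w : V),
      ∑ i, ρ i * (g (B.x i) (B.x j) * g (B.x i) w) = ρ j * g (B.x j) w := by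
    intro ρ j w
    simp [B.x_x]
  cases c with
  | one =>
    refine exists_congr fun ρ₁ => exists_congr fun ρ₂ => exists_congr fun ρ =>
      B.eq_iff_mixed hg _ _ ?_ ?_ ?_
    · intro w
      simp [symDyad, dyad, B.l_l, B.m_l, B.x_l]; ring
    · intro w
      simp [symDyad, dyad, B.l_m, B.m_m, B.x_m]; ring
    · intro i w
      simp [symDyad, dyad, B.l_x, B.m_x, hx]
  | two =>
    refine exists_congr fun ρ₁ => exists_congr fun ε => exists_congr fun ρ =>
      and_congr_right fun _ => B.eq_iff_mixed hg _ _ ?_ ?_ ?_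
    · intro w
      simp [symDyad, dyad, B.l_l, B.m_l, B.x_l]; ring
    · intro w
      simp [symDyad, dyad, B.l_m, B.m_m, B.x_m]; ring
    · intro i w
      simp [symDyad, dyad, B.l_x, B.m_x, hx]
  | three =>
    refine exists_congr fun ρ₁ => exists_congr fun ρ => exists_congr fun i₁ =>
      and_congr_right fun _ => and_congr_right fun _ => B.eq_iff_mixed hg _ _ ?_ ?_ ?_
    · intro w
      simp [symDyad, dyad, B.l_l, B.m_l, B.x_l]; ring
    · intro w
      simp [symDyad, dyad, B.l_m, B.m_m, B.x_m]; ring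
    · intro i w
      by_cases h : i = i₁
      · subst h
        simp [symDyad, dyad, B.l_x, B.m_x, B.x_x]
      · simp [symDyad, dyad, B.l_x, B.m_x, B.x_x, h, Ne.symm h]
  | complex =>
    refine exists_congr fun ρ₁ => exists_congr fun ρ₂ => exists_congr fun ρ =>
      and_congr_right fun _ => B.eq_iff_mixed hg _ _ ?_ ?_ ?_
    · intro w
      simp [symDyad, dyad, B.l_l, B.m_l, B.x_l]; ring
    · intro w
      simp [symDyad, dyad, B.l_m, B.m_m, B.x_m]; ring
    · intro i w
      simp [symDyad, dyad, B.l_x, B.m_x, hx]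

end SemiNullBasis

end SemiNull

/-! ## Existence of a canonical form -/

section Primary

open Polynomial

variable {g : LinearMap.BilinForm ℝ V} {T : Module.End ℝ V}

theorem selfAdjoint_pow {N : Module.End ℝ V} (hN : ∀ u v, g (N u) v = g u (N v)) (i : ℕ) :
    ∀ u v, g ((N ^ i) u) v = g u ((N ^ i) v) := by
  induction i with
  | zero => simp
  | succ i ih =>
    intro u v
    rw [pow_succ, Module.End.mul_apply, ih, hN, ← Module.End.mul_apply, ← pow_succ', pow_succ]

theorem selfAdjoint_aeval (hT : ∀ u v, g (T u) v = g u (T v)) (p : ℝ[X]) :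
    ∀ u v, g (aeval T p u) v = g u (aeval T p v) := by
  induction p using Polynomial.induction_on' with
  | add p q hp hq =>
    intro u v
    simp [hp u v, hq u v]
  | monomial i a =>
    intro u v
    simp [aeval_monomial, selfAdjoint_pow hT i u v]

/-- A time-like vector that is killed by a polynomial in the self-adjoint operator `T` has a
time-like primary component. -/
theorem exists_timelike_primary (hs : ∀ u v, g u v = g v u)
    (hT : ∀ u v, g (T u) v = g u (T v)) (q : ℝ[X]) (hq : q ≠ 0) :
    ∀ v, aeval T q v = 0 → g v v < 0 →
      ∃ p : ℝ[X], Irreducible p ∧ ∃ (i : ℕ) (w : V), aeval T (p ^ i) w = 0 ∧ g w w < 0 := by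
  induction q using UniqueFactorizationMonoid.induction_on_coprime with
  | h0 => exact absurd rfl hq
  | h1 hu =>
    intro v hv hneg
    obtain ⟨u, rfl⟩ := hu
    have : v = aeval T ((u⁻¹ : ℝ[X]ˣ) * u : ℝ[X]) v := by simp
    rw [map_mul, Module.End.mul_apply, hv, map_zero] at this
    simp [this] at hneg
  | hpr i hp =>
    rename_i p
    intro v hv hneg
    exact ⟨p, hp.irreducible, i, v, hv, hneg⟩
  | hcp hxy hx hy =>
    rename_i x y
    intro v hv hneg
    obtain ⟨a, b, hab⟩ := hxy.isCoprime
    have hx0 : x ≠ 0 := left_ne_zero_of_mul hq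
    have hy0 : y ≠ 0 := right_ne_zero_of_mul hq
    -- Bézout splits `v` into parts killed by `x` and by `y`. Moving `b * y` across `g` makes it act
    -- on `v2`, which `y` kills, so the parts are orthogonal and one of them is time-like.
    set v1 := aeval T (b * y) v with hv1
    set v2 := aeval T (a * x) v with hv2
    have h1 : aeval T x v1 = 0 := by
      rw [hv1, ← Module.End.mul_apply, ← map_mul, show x * (b * y) = b * (x * y) by ring, map_mul,
        Module.End.mul_apply, hv, map_zero]
    have h2 : aeval T y v2 = 0 := by
      rw [hv2, ← Module.End.mul_apply, ← map_mul, show y * (a * x) = a * (x * y) by ring, map_mul,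
        Module.End.mul_apply, hv, map_zero]
    have h12 : g v1 v2 = 0 := by
      rw [hv1, selfAdjoint_aeval hT, map_mul, Module.End.mul_apply, h2]
      simp
    have hsum : v = v2 + v1 := by
      rw [hv1, hv2, ← LinearMap.add_apply, ← map_add, hab]
      simp
    rw [hsum] at hneg
    simp only [map_add, LinearMap.add_apply, hs v2 v1, h12] at hneg
    by_cases hc : g v1 v1 < 0
    · exact hx hx0 v1 h1 hc
    · exact hy hy0 v2 h2 (by linarith)

theorem exists_ne_zero_apply_eq_zero {S : Module.End ℝ V} {w : V} (hw : w ≠ 0) {i : ℕ}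
    (h : (S ^ i) w = 0) : ∃ u, u ≠ 0 ∧ S u = 0 := by
  induction i with
  | zero => exact absurd (by simpa using h) hw
  | succ i ih =>
    by_cases h0 : (S ^ i) w = 0
    · exact ih h0
    · exact ⟨_, h0, by rw [← Module.End.mul_apply, ← pow_succ', h]⟩

/-- Either `T` has a pair of non-real eigenvalues, or one of its real generalised eigenspaces
contains a time-like vector. -/
theorem exists_complex_pair_or_timelike [FiniteDimensional ℝ V] (hs : ∀ u v, g u v = g v u)
    (hT : ∀ u v, g (T u) v = g u (T v)) (htl : ∃ v, g v v < 0) :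
    (∃ (α β : ℝ) (u v : V), β ≠ 0 ∧ u ≠ 0 ∧ T u = α • u - β • v ∧ T v = β • u + α • v) ∨
    ∃ (a : ℝ) (i : ℕ) (v : V), ((T - algebraMap ℝ _ a) ^ i) v = 0 ∧ g v v < 0 := by
  obtain ⟨v, hv⟩ := htl
  obtain ⟨p, hp, i, w, hw, hneg⟩ := exists_timelike_primary hs hT (minpoly ℝ T)
    (minpoly.ne_zero (Algebra.IsIntegral.isIntegral T)) v (by simp) hv
  have hw0 : w ≠ 0 := by rintro rfl; simp at hneg
  obtain ⟨z, hz⟩ := IsAlgClosed.exists_aeval_eq_zero ℂ p (degree_pos_of_irreducible hp).ne'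
  by_cases him : z.im = 0
  · right
    have hroot : p.IsRoot z.re := by
      have hz' : z = algebraMap ℝ ℂ z.re := Complex.ext (by simp) (by simp [him])
      rw [hz', aeval_algebraMap_apply] at hz
      simpa using hz
    have hdvd : X - C z.re ∣ p := dvd_iff_isRoot.2 hroot
    have hdvd' : p ∣ X - C z.re :=
      ((irreducible_X_sub_C z.re).associated_of_dvd hp hdvd).symm.dvd
    refine ⟨z.re, i, w, ?_, hneg⟩
    obtain ⟨r, hr⟩ := pow_dvd_pow_of_dvd hdvd' i
    have : aeval T ((X - C z.re) ^ i) w = 0 := by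
      rw [hr, mul_comm, map_mul, Module.End.mul_apply, hw, map_zero]
    simpa using this
  · left
    have hdvd := p.quadratic_dvd_of_aeval_eq_zero_im_ne_zero hz him
    -- `Q` is `(X - z) (X - z̄)`. It divides the irreducible `p` and is not a unit, so it is
    -- associated to `p`.
    set Q : ℝ[X] := X ^ 2 - C (2 * z.re) * X + C (‖z‖ ^ 2) with hQ
    have hQu : ¬ IsUnit Q := by
      intro hu
      have hz0 : aeval z Q = 0 := by
        have h1 : algebraMap ℝ ℂ (2 * z.re) = z + starRingEnd ℂ z := (Complex.add_conj z).symm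
        have h2 : algebraMap ℝ ℂ (‖z‖ ^ 2) = z * starRingEnd ℂ z := by
          rw [Complex.mul_conj', map_pow]; rfl
        rw [hQ, map_add, map_sub, map_mul, map_pow, aeval_X, aeval_C, aeval_C, h1, h2]
        ring
      exact not_isUnit_zero (hz0 ▸ hu.map (aeval z))
    obtain ⟨r, hr⟩ := hdvd
    have hdvd' : p ∣ Q := by
      rcases hp.isUnit_or_isUnit hr with h | h
      · exact absurd h hQu
      · obtain ⟨u, rfl⟩ := h
        exact ⟨(u⁻¹ : ℝ[X]ˣ), by rw [hr, mul_assoc, Units.mul_inv, mul_one]⟩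
    have hQw : ((aeval T Q) ^ i) w = 0 := by
      obtain ⟨r, hr⟩ := pow_dvd_pow_of_dvd hdvd' i
      rw [← map_pow, hr, mul_comm, map_mul, Module.End.mul_apply, hw, map_zero]
    obtain ⟨u, hu0, hu⟩ := exists_ne_zero_apply_eq_zero hw0 hQw
    have hu' : T (T u) = (2 * z.re) • T u - (z.re ^ 2 + z.im ^ 2) • u := by
      have hn : ‖z‖ ^ 2 = z.re ^ 2 + z.im ^ 2 := by
        rw [← Complex.normSq_eq_norm_sq, Complex.normSq_apply]; ring
      rw [hQ, hn] at hu
      simp only [map_add, map_sub, map_mul, aeval_X, aeval_C, pow_two,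
        LinearMap.add_apply, LinearMap.sub_apply, Module.End.mul_apply,
        Module.algebraMap_end_apply] at hu
      rw [pow_two, pow_two, ← sub_eq_zero, ← hu]
      module
    -- The second vector is solved from the first equation; the second equation is then `Q(T) u =
    -- 0`.
    refine ⟨z.re, z.im, u, z.im⁻¹ • (z.re • u - T u), him, hu0, ?_, ?_⟩
    · rw [smul_smul, mul_inv_cancel₀ him, one_smul]; abel
    · rw [map_smul, map_sub, map_smul, hu']
      match_scalars <;> field_simp <;> ring

end Primary

/-! ### Normal forms for an invariant plane or a Jordan chain. -/

section Existence

variable {g : LinearMap.BilinForm ℝ V} {T : Module.End ℝ V}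

/-- If a real generalised eigenspace contains a time-like vector, it contains a time-like
eigenvector or the top of a Jordan chain `z, N z, …, N ^ p z` that pairs non-trivially with itself.
-/
theorem exists_timelike_eigenvector_or_chain (hs : ∀ u v, g u v = g v u)
    (hp : PosOnHyperplane g) {N : Module.End ℝ V} (hN : ∀ u v, g (N u) v = g u (N v))
    {i : ℕ} {v : V} (hi : (N ^ i) v = 0) (hv : g v v < 0) :
    N v = 0 ∨ ∃ (p : ℕ) (z : V), 1 ≤ p ∧ (N ^ (p + 1)) z = 0 ∧ g ((N ^ p) z) z ≠ 0 := by
  classical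
  have hv0 : v ≠ 0 := by rintro rfl; simp at hv
  have hex : ∃ q, ∀ w, (N ^ i) w = 0 → (N ^ q) w = 0 := ⟨i, fun w h => h⟩
  -- `q` is the nilpotency index of `N` on the kernel of `N ^ i`.
  obtain ⟨q, hq, hmin⟩ : ∃ q, (∀ w, (N ^ i) w = 0 → (N ^ q) w = 0) ∧
      ∀ q' < q, ¬ ∀ w, (N ^ i) w = 0 → (N ^ q') w = 0 :=
    ⟨Nat.find hex, Nat.find_spec hex, fun _ h => Nat.find_min hex h⟩
  rcases q with _ | _ | p
  · exact absurd (by simpa using hq v hi) hv0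
  · left
    simpa using hq v hi
  · right
    have := hmin (p + 1) (by omega)
    push Not at this
    obtain ⟨w, hwi, hw⟩ := this
    set P := N ^ (p + 1) with hP
    have hPs : ∀ u v, g (P u) v = g u (P v) := selfAdjoint_pow hN _
    have hkill : ∀ z, (N ^ i) z = 0 → (N ^ (p + 1 + 1)) z = 0 := hq
    have hPP : P (P w) = 0 := by
      rw [hP, ← Module.End.mul_apply, ← pow_add, show p + 1 + (p + 1) = p + (p + 1 + 1) by ring,
        pow_add, Module.End.mul_apply, hq w hwi, map_zero]
    have hnull : g (P w) (P w) = 0 := by rw [hPs, hPP, map_zero]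
    -- A nonzero null vector is never orthogonal to a time-like one.
    have hpair : g v (P w) ≠ 0 := fun h0 =>
      (hp.pos_of_orthogonal_timelike hs hv h0 hw).ne' hnull
    by_contra! hcon
    -- Polarisation: if the symmetric form `g (P ·) ·` vanished on the diagonal at `w`, `v` and `w +
    -- v`, then `g (P w) v` would vanish too.
    have hall : ∀ z, (N ^ i) z = 0 → g (P z) z = 0 := fun z hz =>
      hcon (p + 1) z (by omega) (hq z hz)
    have h1 := hall w hwi
    have h2 := hall v hi
    have h3 := hall (w + v) (by rw [map_add, hwi, hi, add_zero])
    simp only [map_add, LinearMap.add_apply, h1, h2] at h3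
    rw [hPs v w, hs (P w) v] at h3
    exact hpair (by linarith)

/-- The vector `l - m` has square `-2`, hence is time-like. -/
theorem pos_of_orthogonal_null_pair (hs : ∀ u v, g u v = g v u) (hp : PosOnHyperplane g)
    {l m w : V} (ll : g l l = 0) (mm : g m m = 0) (lm : g l m = 1) (hl : g l w = 0)
    (hm : g m w = 0) (hw : w ≠ 0) : 0 < g w w := by
  refine hp.pos_of_orthogonal_timelike hs (v := l - m) ?_ (by simp [hl, hm]) hw
  simp [ll, mm, lm, hs m l]

theorem linearIndependent_null_pair (hs : ∀ u v, g u v = g v u)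
    {l m : V} (ll : g l l = 0) (mm : g m m = 0) (lm : g l m = 1) :
    LinearIndependent ℝ ![l, m] := by
  rw [LinearIndependent.pair_iff]
  intro s t h
  have h1 := congrArg (g l) h
  have h2 := congrArg (g m) h
  simp [ll, mm, lm, hs m l] at h1 h2
  exact ⟨h2, h1⟩

variable [FiniteDimensional ℝ V]

/-- A null pair spanning an invariant plane is completed to a semi-null basis by eigenvectors. -/
theorem exists_semiNullBasis_of_invariant_pair (hnd : g.Nondegenerate) (hs : ∀ u v, g u v = g v u)
    (hp : PosOnHyperplane g) (hT : ∀ u v, g (T u) v = g u (T v)) {k : ℕ}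
    (hk : Module.finrank ℝ V = k + 2) {l m : V} (ll : g l l = 0) (mm : g m m = 0)
    (lm : g l m = 1) {a b c d : ℝ} (hl : T l = a • l + b • m) (hm : T m = c • l + d • m) :
    ∃ (B : SemiNullBasis g k) (ρ : Fin k → ℝ), B.l = l ∧ B.m = m ∧
      ∀ i, T (B.x i) = ρ i • B.x i := by
  obtain ⟨y, ρ, hy, hdy, hyy⟩ := exists_orthonormal_eigenvectors_orthogonal hnd hs hT ![l, m]
    (linearIndependent_null_pair hs ll mm lm) (k := k)
    (by
      have hl' : l ∈ Submodule.span ℝ (Set.range ![l, m]) := Submodule.subset_span ⟨0, rfl⟩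
      have hm' : m ∈ Submodule.span ℝ (Set.range ![l, m]) := Submodule.subset_span ⟨1, rfl⟩
      rw [Fin.forall_fin_two]
      constructor
      · change T l ∈ _
        rw [hl]
        exact add_mem (Submodule.smul_mem _ _ hl') (Submodule.smul_mem _ _ hm')
      · change T m ∈ _
        rw [hm]
        exact add_mem (Submodule.smul_mem _ _ hl') (Submodule.smul_mem _ _ hm'))
    (fun w hw h0 => pos_of_orthogonal_null_pair hs hp ll mm lm (hw 0) (hw 1) h0)
    (by omega)
  exact ⟨.ofGram hs hk l m y ll mm lm (hdy 0) (hdy 1) hyy, ρ, rfl, rfl, hy⟩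

/-- The vector `u + i v` is an eigenvector for `α + i β`. Self-adjointness makes it orthogonal to
its conjugate, that is `g u u + g v v = 0`, and its own complex square is `2 (g u u + i g u v)`.
This is nonzero: otherwise `u` and `v` would be orthogonal null vectors, hence proportional,
contradicting `β ≠ 0`. -/
theorem exists_canonicalAction_of_complex_pair (hnd : g.Nondegenerate)
    (hs : ∀ u v, g u v = g v u) (hp : PosOnHyperplane g) (hT : ∀ u v, g (T u) v = g u (T v))
    {k : ℕ} (hk : Module.finrank ℝ V = k + 2) {α β : ℝ} {u v : V} (hβ : β ≠ 0) (hu0 : u ≠ 0)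
    (hu : T u = α • u - β • v) (hv : T v = β • u + α • v) :
    ∃ B : SemiNullBasis g k, B.CanonicalAction T .complex := by
  have huv : g u u + g v v = 0 := by
    have := hT u v
    rw [hu, hv] at this
    simp only [map_add, map_sub, map_smul, LinearMap.sub_apply, LinearMap.smul_apply,
      smul_eq_mul] at this
    have h : β * (g u u + g v v) = 0 := by linarith
    exact (mul_eq_zero.1 h).resolve_left hβ
  have hne : (⟨g u u, g u v⟩ : ℂ) ≠ 0 := by
    intro h0
    have huu : g u u = 0 := congrArg Complex.re h0
    have hc : g u v = 0 := congrArg Complex.im h0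
    obtain ⟨c, rfl⟩ := hp.proportional_of_null hs (v := v) (w := u) (by linarith) huu
      (by rw [hs, hc]) hu0
    rw [map_smul, hu] at hv
    have h : (β * (1 + c ^ 2)) • u = 0 := by
      rw [← sub_eq_zero.2 hv.symm]
      module
    rcases smul_eq_zero.1 h with h | h
    · rcases mul_eq_zero.1 h with h | h
      · exact hβ h
      · nlinarith [sq_nonneg c]
    · exact hu0 h
  -- Write `s (u + i v) = l + i m`. This `s` makes the complex square `2 i`, which says that `l l =
  -- m m` and `l m = 1`; orthogonality to the conjugate adds `l l + m m = 0`.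
  obtain ⟨s, hsq⟩ := IsAlgClosed.exists_pow_nat_eq (Complex.I / ⟨g u u, g u v⟩ : ℂ) two_pos
  have hsq' : s * s * ⟨g u u, g u v⟩ = Complex.I := by
    rw [← pow_two, hsq, div_mul_cancel₀ _ hne]
  have hre := congrArg Complex.re hsq'
  have him := congrArg Complex.im hsq'
  simp only [Complex.mul_re, Complex.mul_im, Complex.I_re, Complex.I_im] at hre him
  have hvv : g v v = - g u u := by linarith
  obtain ⟨B, ρ, hBl, hBm, hBx⟩ := exists_semiNullBasis_of_invariant_pair hnd hs hp hT hk
    (l := s.re • u - s.im • v) (m := s.im • u + s.re • v) (a := α) (b := -β) (c := β) (d := α)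
    (by simp [hs v u, hvv]; linarith) (by simp [hs v u, hvv]; linarith)
    (by simp [hs v u, hvv]; linarith)
    (by rw [map_sub, map_smul, map_smul, hu, hv]; module)
    (by rw [map_add, map_smul, map_smul, hu, hv]; module)
  refine ⟨B, α, β, ρ, hβ, ?_, ?_, hBx⟩
  · rw [hBl, hBm, map_sub, map_smul, map_smul, hu, hv]; module
  · rw [hBl, hBm, map_add, map_smul, map_smul, hu, hv]; module

theorem exists_canonicalAction_of_timelike_eigenvector (hnd : g.Nondegenerate)
    (hs : ∀ u v, g u v = g v u) (hp : PosOnHyperplane g) (hT : ∀ u v, g (T u) v = g u (T v))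
    {k : ℕ} (hk : Module.finrank ℝ V = k + 2) {a : ℝ} {v : V} (hv : g v v < 0)
    (hTv : T v = a • v) :
    ∃ B : SemiNullBasis g k, B.CanonicalAction T .one := by
  obtain ⟨r, hr⟩ : ∃ r : ℝ, r * r * g v v = -1 := by
    refine ⟨(√(-g v v))⁻¹, ?_⟩
    rw [← mul_inv, Real.mul_self_sqrt (by linarith), inv_neg, neg_mul, inv_mul_cancel₀ hv.ne]
  set u := r • v with hu
  have huu : g u u = -1 := by simp [hu, ← mul_assoc, hr]
  have hTu : T u = a • u := by rw [hu, map_smul, hTv, smul_comm]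
  have hu0 : u ≠ 0 := by rintro h; simp [h] at huu
  obtain ⟨y, ρ, hy, hdy, hyy⟩ := exists_orthonormal_eigenvectors_orthogonal hnd hs hT ![u]
    (by simpa [linearIndependent_unique_iff] using hu0) (k := k + 1)
    (fun i => by
      have : i = 0 := Subsingleton.elim _ _
      subst this
      simp only [Matrix.cons_val_fin_one, hTu]
      exact Submodule.smul_mem _ _ (Submodule.subset_span ⟨0, rfl⟩))
    (fun w hw h0 => hp.pos_of_orthogonal_timelike hs (v := u) (by linarith) (hw 0) h0)
    (by omega)
  have hdy : ∀ i, g u (y i) = 0 := hdy 0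
  have hdy' : ∀ i, g (y i) u = 0 := fun i => (hs _ _).trans (hdy i)
  -- The space-like eigenvector `y 0` and the time-like `u` span a plane whose null directions are
  -- `y 0 ± u`.
  obtain ⟨c, hc⟩ : ∃ c : ℝ, c * c = 1 / 2 := ⟨√(1 / 2), Real.mul_self_sqrt (by norm_num)⟩
  have h0 : ∀ i : Fin k, (0 : Fin (k + 1)) ≠ i.succ := fun i => (Fin.succ_ne_zero i).symm
  refine ⟨.ofGram hs hk (c • (y 0 + u)) (c • (y 0 - u)) (fun i => y i.succ) ?_ ?_ ?_ ?_ ?_ ?_,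
    (ρ 0 + a) / 2, (ρ 0 - a) / 2, fun i => ρ i.succ, ?_, ?_, fun i => hy i.succ⟩
  · simp [hyy, huu, hdy, hdy']
  · simp [hyy, huu, hdy, hdy']
  · simp [hyy, huu, hdy, hdy']; linarith
  · intro i; simp [hyy, hdy, h0]
  · intro i; simp [hyy, hdy, h0]
  · intro i j; simp [hyy]
  · change T (c • (y 0 + u)) = _ • c • (y 0 + u) + _ • c • (y 0 - u)
    rw [map_smul, map_add, hy, hTu]; module
  · change T (c • (y 0 - u)) = _ • c • (y 0 + u) + _ • c • (y 0 - u)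
    rw [map_smul, map_sub, hy, hTu]; module

theorem exists_canonicalAction_of_chain_two (hnd : g.Nondegenerate)
    (hs : ∀ u v, g u v = g v u) (hp : PosOnHyperplane g) (hT : ∀ u v, g (T u) v = g u (T v))
    {k : ℕ} (hk : Module.finrank ℝ V = k + 2) {a : ℝ} {e₀ e₁ : V}
    (h0 : T e₀ = e₁ + a • e₀) (h1 : T e₁ = a • e₁) (h10 : g e₁ e₀ ≠ 0) :
    ∃ B : SemiNullBasis g k, B.CanonicalAction T .two := by
  have h11 : g e₁ e₁ = 0 := by
    have := hT e₀ e₁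
    rw [h0, h1] at this
    simpa using this
  -- Rescaling the chain multiplies `g e₁ e₀` by a positive square, so its sign `ε` survives as the
  -- `±` of the canonical form.
  obtain ⟨r, ε, hε, hr⟩ : ∃ r ε : ℝ, (ε = 1 ∨ ε = -1) ∧ ε * (r * r * g e₁ e₀) = 1 := by
    rcases lt_or_gt_of_ne h10 with h | h
    · refine ⟨(√(-g e₁ e₀))⁻¹, -1, Or.inr rfl, ?_⟩
      rw [← mul_inv, Real.mul_self_sqrt (by linarith)]
      field_simp
    · refine ⟨(√(g e₁ e₀))⁻¹, 1, Or.inl rfl, ?_⟩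
      rw [← mul_inv, Real.mul_self_sqrt h.le]
      field_simp
  have hεε : ε * ε = 1 := by rcases hε with rfl | rfl <;> norm_num
  set l := (ε * r) • e₁ with hl
  -- The multiple of the eigenvector `l` makes `m` null; it alters neither `g l m` nor `(T - a) m`.
  set m := r • e₀ - (r * r * g e₀ e₀ / 2) • l with hm
  have ll : g l l = 0 := by simp [hl, h11]
  have le : g l e₀ = ε * r * g e₁ e₀ := by simp [hl]
  have lm : g l m = 1 := by
    simp only [hm, map_sub, map_smul, ll, le, smul_eq_mul]
    linarith
  have mm : g m m = 0 := by
    have e : r * g e₀ l = 1 := by rw [hs, le]; linarith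
    have e' : r * g l e₀ = 1 := by rw [le]; linarith
    simp only [hm, map_sub, map_smul, LinearMap.sub_apply, LinearMap.smul_apply, ll, smul_eq_mul]
    linear_combination (-(r * r * g e₀ e₀ / 2)) * e - (r * r * g e₀ e₀ / 2) * e'
  have hTl : T l = a • l := by rw [hl, map_smul, h1, smul_comm]
  have hTm : T m = ε • l + a • m := by
    have : ε • l = r • e₁ := by rw [hl, smul_smul, ← mul_assoc, hεε, one_mul]
    rw [this, hm, map_sub, map_smul, map_smul, h0, hTl]; module
  obtain ⟨B, ρ, hBl, hBm, hBx⟩ := exists_semiNullBasis_of_invariant_pair hnd hs hp hT hk ll mm lm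
    (a := a) (b := 0) (c := ε) (d := a) (by rw [hTl]; module) hTm
  exact ⟨B, a, ε, ρ, hε, by rw [hBl, hTl], by rw [hBl, hBm, hTm], hBx⟩

/-- Products along the chain depend only on the sum of the indices, so `g e₁ e₁ = g e₂ e₀`. This is
positive, since a time-like `e₁` would be orthogonal to the nonzero null vector `e₂`; hence no sign
occurs in this form. -/
theorem exists_canonicalAction_of_chain_three (hnd : g.Nondegenerate)
    (hs : ∀ u v, g u v = g v u) (hp : PosOnHyperplane g) (hT : ∀ u v, g (T u) v = g u (T v))
    {k : ℕ} (hk : Module.finrank ℝ V = k + 3) {a : ℝ} {e₀ e₁ e₂ : V}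
    (h0 : T e₀ = e₁ + a • e₀) (h1 : T e₁ = e₂ + a • e₁) (h2 : T e₂ = a • e₂)
    (h20 : g e₂ e₀ ≠ 0) :
    ∃ B : SemiNullBasis g (k + 1), B.CanonicalAction T .three := by
  have g12 : g e₁ e₂ = 0 := by
    have := hT e₀ e₂
    rw [h0, h2] at this
    simpa using this
  have g22 : g e₂ e₂ = 0 := by
    have := hT e₁ e₂
    rw [h1, h2] at this
    simpa using this
  have g11 : g e₁ e₁ = g e₂ e₀ := by
    have := hT e₁ e₀
    rw [h1, h0] at this
    simpa using this.symm
  have hpos : 0 < g e₁ e₁ := by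
    rcases lt_or_gt_of_ne (g11 ▸ h20 : g e₁ e₁ ≠ 0) with h | h
    · refine absurd g22 (hp.pos_of_orthogonal_timelike hs h g12 ?_).ne'
      rintro rfl
      simp at h20
    · exact h
  obtain ⟨r, hr⟩ : ∃ r : ℝ, r * r * g e₁ e₁ = 1 := by
    refine ⟨(√(g e₁ e₁))⁻¹, ?_⟩
    rw [← mul_inv, Real.mul_self_sqrt hpos.le]
    field_simp
  set f₀ := r • e₀ with hf₀
  set f₁ := r • e₁ with hf₁
  set l := r • e₂ with hf₂
  have t0 : T f₀ = f₁ + a • f₀ := by rw [hf₀, hf₁, map_smul, h0]; module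
  have t1 : T f₁ = l + a • f₁ := by rw [hf₁, hf₂, map_smul, h1]; module
  have t2 : T l = a • l := by rw [hf₂, map_smul, h2]; module
  have k11 : g f₁ f₁ = 1 := by simp [hf₁, ← mul_assoc, hr]
  have k12 : g f₁ l = 0 := by simp [hf₁, hf₂, g12]
  have k21 : g l f₁ = 0 := by rw [hs, k12]
  have k22 : g l l = 0 := by simp [hf₂, g22]
  have k20 : g l f₀ = 1 := by simp [hf₀, hf₂, ← g11, ← mul_assoc, hr]
  have k02 : g f₀ l = 1 := by rw [hs, k20]
  have k01 : g f₀ f₁ = g f₁ f₀ := hs _ _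
  clear_value f₀ f₁ l
  -- With `N = T - a`, replace `f₀` by `m = (1 + s N + t N²) f₀` and set `x = N m`. The relations on
  -- `s` and `t` are `g m x = 0` and `g m m = 0`.
  obtain ⟨s, hs1⟩ : ∃ s : ℝ, g f₁ f₀ + 2 * s = 0 := ⟨-(g f₁ f₀ / 2), by ring⟩
  obtain ⟨t, ht⟩ : ∃ t : ℝ, g f₀ f₀ + 2 * s * g f₁ f₀ + s ^ 2 + 2 * t = 0 :=
    ⟨-((g f₀ f₀ + 2 * s * g f₁ f₀ + s ^ 2) / 2), by ring⟩
  set x := f₁ + s • l with hx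
  set m := f₀ + s • f₁ + t • l with hm
  have mm : g m m = 0 := by
    simp [hm, k11, k12, k21, k22, k20, k02, k01]; linarith
  have lm : g l m = 1 := by simp [hm, k21, k22, k20]
  have ml : g m l = 1 := by rw [hs, lm]
  have lx : g l x = 0 := by simp [hx, k21, k22]
  have xl : g x l = 0 := by rw [hs, lx]
  have mx : g m x = 0 := by
    simp [hm, hx, k11, k12, k21, k22, k02, k01]; linarith
  have xm : g x m = 0 := by rw [hs, mx]
  have xx : g x x = 1 := by simp [hx, k11, k12, k21, k22]
  have tm : T m = x + a • m := by
    rw [hm, hx, map_add, map_add, map_smul, map_smul, t0, t1, t2]; module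
  have tx : T x = l + a • x := by
    rw [hx, map_add, map_smul, t1, t2]; module
  obtain ⟨y, ρ, hy, hdy, hyy⟩ := exists_orthonormal_eigenvectors_orthogonal hnd hs hT ![l, m, x]
    (by
      rw [Fintype.linearIndependent_iff]
      intro c hc
      simp only [Fin.sum_univ_three, Matrix.cons_val_zero, Matrix.cons_val_one,
        Matrix.cons_val] at hc
      have c0 := congrArg (g m) hc
      have c1 := congrArg (g l) hc
      have c2 := congrArg (g x) hc
      simp [mm, ml, mx] at c0
      simp [k22, lm, lx] at c1
      simp [xm, xl, xx] at c2
      intro i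
      fin_cases i <;> assumption) (k := k)
    (by
      have hl' : l ∈ Submodule.span ℝ (Set.range ![l, m, x]) := Submodule.subset_span ⟨0, rfl⟩
      have hm' : m ∈ Submodule.span ℝ (Set.range ![l, m, x]) := Submodule.subset_span ⟨1, rfl⟩
      have hx' : x ∈ Submodule.span ℝ (Set.range ![l, m, x]) := Submodule.subset_span ⟨2, rfl⟩
      intro i
      fin_cases i
      · change T l ∈ _
        rw [t2]
        exact Submodule.smul_mem _ _ hl'
      · change T m ∈ _
        rw [tm]
        exact add_mem hx' (Submodule.smul_mem _ _ hm')
      · change T x ∈ _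
        rw [tx]
        exact add_mem hl' (Submodule.smul_mem _ _ hx'))
    (fun w hw h0 => pos_of_orthogonal_null_pair hs hp k22 mm lm (hw 0) (hw 1) h0)
    (by omega)
  have ly : ∀ i, g l (y i) = 0 := hdy 0
  have my : ∀ i, g m (y i) = 0 := hdy 1
  have xy : ∀ i, g x (y i) = 0 := hdy 2
  refine ⟨.ofGram hs (by omega) l m (Fin.cons x y) k22 mm lm ?_ ?_ ?_,
    a, Fin.cons a ρ, 0, rfl, rfl, t2, tm, ?_⟩
  · intro i
    cases i using Fin.cases with
    | zero => exact lx
    | succ i => exact ly i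
  · intro i
    cases i using Fin.cases with
    | zero => exact mx
    | succ i => exact my i
  · intro i j
    cases i using Fin.cases with
    | zero =>
      cases j using Fin.cases with
      | zero => simpa using xx
      | succ j => simpa [(Fin.succ_ne_zero j).symm] using xy j
    | succ i =>
      cases j using Fin.cases with
      | zero => simpa using (hs _ _).trans (xy i)
      | succ j => simpa using hyy i j
  · intro i
    cases i using Fin.cases with
    | zero => simpa [SemiNullBasis.ofGram] using tx
    | succ i => simpa [SemiNullBasis.ofGram] using hy i

theorem exists_canonicalAction (hnd : g.Nondegenerate)
    (hs : ∀ u v, g u v = g v u) (hp : PosOnHyperplane g) (htl : ∃ v, g v v < 0)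
    (hT : ∀ u v, g (T u) v = g u (T v)) {k : ℕ} (hk : Module.finrank ℝ V = k + 3) :
    ∃ (c : SegreClass) (B : SemiNullBasis g (k + 1)), B.CanonicalAction T c := by
  rcases exists_complex_pair_or_timelike hs hT htl with
    ⟨α, β, u, v, hβ, hu0, hu, hv⟩ | ⟨a, i, v, hi, hv⟩
  · exact ⟨_, exists_canonicalAction_of_complex_pair hnd hs hp hT hk hβ hu0 hu hv⟩
  set N := T - algebraMap ℝ (Module.End ℝ V) a with hN
  have hTN : ∀ u, T u = N u + a • u := fun u => by simp [hN]
  have hNs : ∀ u v, g (N u) v = g u (N v) := fun u v => by simp [hN, hT]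
  rcases exists_timelike_eigenvector_or_chain hs hp hNs hi hv with h | ⟨p, z, h1, hz, hne⟩
  · exact ⟨_, exists_canonicalAction_of_timelike_eigenvector hnd hs hp hT hk hv
      (a := a) (by rw [hTN, h, zero_add])⟩
  rcases p with _ | _ | _ | p
  · omega
  · have h2 : N (N z) = 0 := by simpa [pow_succ] using hz
    exact ⟨_, exists_canonicalAction_of_chain_two hnd hs hp hT hk (hTN z)
      (by rw [hTN, h2, zero_add]) (by simpa using hne)⟩
  · have h3 : N (N (N z)) = 0 := by simpa [pow_succ] using hz
    exact ⟨_, exists_canonicalAction_of_chain_three hnd hs hp hT hk (hTN z) (hTN _)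
      (by rw [hTN, h3, zero_add]) (by simpa [pow_succ] using hne)⟩
  -- A chain of length at least four: its last two vectors are null and orthogonal, hence
  -- proportional, and applying `N` kills the last one.
  · exfalso
    have hhigh : ∀ j, (N ^ (p + 4 + j)) z = 0 := fun j => by
      rw [add_comm, pow_add, Module.End.mul_apply, hz, map_zero]
    have hprod : ∀ i j, g ((N ^ i) z) ((N ^ j) z) = g ((N ^ (i + j)) z) z := fun i j => by
      rw [add_comm, pow_add, Module.End.mul_apply, selfAdjoint_pow hNs j]
    have hprod0 : ∀ i j, p + 4 ≤ i + j → g ((N ^ i) z) ((N ^ j) z) = 0 := fun i j hij => by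
      obtain ⟨r, hr⟩ := Nat.exists_eq_add_of_le hij
      rw [hprod, hr, hhigh]
      simp
    have hy0 : (N ^ (p + 3)) z ≠ 0 := fun h => hne (by rw [h]; simp)
    obtain ⟨c, hc⟩ := hp.proportional_of_null hs (v := (N ^ (p + 2)) z) (w := (N ^ (p + 3)) z)
      (hprod0 _ _ (by omega)) (hprod0 _ _ (by omega)) (hprod0 _ _ (by omega)) hy0
    refine hy0 ?_
    rw [pow_succ', Module.End.mul_apply, hc, map_smul, ← Module.End.mul_apply, ← pow_succ', hz,
      smul_zero]

end Existence

/-! ## Jordan forms -/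

section Jordan

theorem jordanBlock_sub (r : ℕ) (μ a : ℂ) :
    jordanBlock r μ - algebraMap ℂ _ a = jordanBlock r (μ - a) := by
  ext i j
  by_cases h : i = j
  · subst h; simp [jordanBlock, Matrix.algebraMap_matrix_apply]
  · simp [jordanBlock, Matrix.algebraMap_matrix_apply, h]

theorem jordanBlock_blockTriangular (r : ℕ) (μ : ℂ) :
    (jordanBlock r μ).BlockTriangular id := by
  intro i j hij
  have hij : j < i := hij
  have h1 : i ≠ j := hij.ne'
  have h2 : i.val + 1 ≠ j.val := by have : j.val < i.val := hij; omega
  simp [jordanBlock, h1, h2]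

theorem jordanBlock_zero_pow (r : ℕ) : jordanBlock r 0 ^ r = 0 := by
  have h := Matrix.aeval_self_charpoly (jordanBlock r 0)
  rw [Matrix.charpoly_of_isUpperTriangular _ (jordanBlock_blockTriangular r 0)] at h
  simpa [jordanBlock] using h

theorem jordanBlock_isUnit (r : ℕ) {μ : ℂ} (hμ : μ ≠ 0) : IsUnit (jordanBlock r μ) := by
  rw [Matrix.isUnit_iff_isUnit_det, Matrix.det_of_isUpperTriangular (jordanBlock_blockTriangular r μ)]
  simp [jordanBlock, hμ]

/-- Either the block is nilpotent and both powers vanish, or it is invertible. -/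
theorem exists_jordanBlock_pow_eq (r p : ℕ) (μ : ℂ) (h : μ ≠ 0 ∨ r ≤ p) :
    ∃ Q, jordanBlock r μ ^ p = Q * jordanBlock r μ ^ (p + 1) := by
  by_cases hμ : μ = 0
  · subst hμ
    refine ⟨0, ?_⟩
    rw [zero_mul]
    exact pow_eq_zero_of_le (h.resolve_left (not_not.2 rfl)) (jordanBlock_zero_pow r)
  · obtain ⟨u, hu⟩ := jordanBlock_isUnit r hμ
    exact ⟨(u⁻¹ : (Matrix (Fin r) (Fin r) ℂ)ˣ), by rw [← hu, pow_succ', Units.inv_mul_cancel_left]⟩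

variable {T : Module.End ℝ V} {N : ℕ} {r : Fin N → ℕ} {μ : Fin N → ℂ}

/-- Block by block, the `p`-th power is a left multiple of the next one. The case `p = 0` shows that
every eigenvalue occurs among the `μ k`, the case `p = 2` that a chain of length three needs a block
of size at least three. -/
theorem HasJordanForm.pow_apply_eq_zero (h : HasJordanForm T r μ) (a : ℂ) (p : ℕ)
    (hp : ∀ k, μ k ≠ a ∨ r k ≤ p) {u : ℂ ⊗[ℝ] V}
    (hu : ((T.baseChange ℂ - algebraMap ℂ _ a : Module.End ℂ (ℂ ⊗[ℝ] V)) ^ (p + 1)) u = 0) :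
    ((T.baseChange ℂ - algebraMap ℂ _ a : Module.End ℂ (ℂ ⊗[ℝ] V)) ^ p) u = 0 := by
  obtain ⟨-, b, hb⟩ := h
  have hb' : LinearMap.toMatrixAlgEquiv b (T.baseChange ℂ) =
      Matrix.blockDiagonal' fun k => jordanBlock (r k) (μ k) := hb
  have hsub : LinearMap.toMatrixAlgEquiv b (T.baseChange ℂ - algebraMap ℂ _ a) =
      Matrix.blockDiagonal' fun k => jordanBlock (r k) (μ k - a) := by
    rw [map_sub, hb', AlgEquiv.commutes]
    have : algebraMap ℂ (Matrix (Σ k, Fin (r k)) (Σ k, Fin (r k)) ℂ) a =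
        Matrix.blockDiagonal' fun k => algebraMap ℂ (Matrix (Fin (r k)) (Fin (r k)) ℂ) a := by
      simp only [Matrix.algebraMap_eq_diagonal]
      rw [Matrix.blockDiagonal'_diagonal]
      rfl
    rw [this, ← Matrix.blockDiagonal'_sub]
    congr 1
    funext k
    exact jordanBlock_sub _ _ _
  choose Q hQ using fun k => exists_jordanBlock_pow_eq (r k) p (μ k - a)
    ((hp k).imp_left sub_ne_zero.2)
  have key : (T.baseChange ℂ - algebraMap ℂ _ a : Module.End ℂ (ℂ ⊗[ℝ] V)) ^ p =
      (LinearMap.toMatrixAlgEquiv b).symm (Matrix.blockDiagonal' Q) *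
        (T.baseChange ℂ - algebraMap ℂ _ a : Module.End ℂ (ℂ ⊗[ℝ] V)) ^ (p + 1) := by
    apply (LinearMap.toMatrixAlgEquiv b).injective
    rw [map_mul, map_pow, map_pow, hsub, AlgEquiv.apply_symm_apply, ← Matrix.blockDiagonal'_pow,
      ← Matrix.blockDiagonal'_pow, ← Matrix.blockDiagonal'_mul]
    congr 1
    funext k
    exact hQ k
  rw [key, Module.End.mul_apply, hu, map_zero]

theorem HasJordanForm.mem_range_of_eigenvector (h : HasJordanForm T r μ) {a : ℂ}
    {u : ℂ ⊗[ℝ] V} (hu0 : u ≠ 0) (hu : T.baseChange ℂ u = a • u) : ∃ k, μ k = a := by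
  by_contra! hcon
  have := h.pow_apply_eq_zero a 0 (fun k => Or.inl (hcon k)) (u := u) (by simp [hu])
  exact hu0 (by simpa using this)

theorem repr_chain_zero {W : Type*} [AddCommGroup W] [Module ℂ W]
    (b : Module.Basis (Σ k, Fin (r k)) ℂ W) (k : Fin N) (h0 : 0 < r k) (p : Σ k, Fin (r k)) :
    b.repr (μ k • b ⟨k, 0, h0⟩) p =
      Matrix.blockDiagonal' (fun k => jordanBlock (r k) (μ k)) p ⟨k, 0, h0⟩ := by
  obtain ⟨k', j⟩ := p
  by_cases hk : k' = k
  · subst hk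
    by_cases hj : j = ⟨0, h0⟩
    · simp [Matrix.blockDiagonal'_apply_eq, jordanBlock, hj]
    · simp [Matrix.blockDiagonal'_apply_eq, jordanBlock, hj]
  · rw [Matrix.blockDiagonal'_apply_ne _ _ _ hk]
    simp [Ne.symm hk]

theorem repr_chain_succ {W : Type*} [AddCommGroup W] [Module ℂ W]
    (b : Module.Basis (Σ k, Fin (r k)) ℂ W) (k : Fin N) (i : ℕ) (hi : i + 1 < r k)
    (p : Σ k, Fin (r k)) :
    b.repr (μ k • b ⟨k, i + 1, hi⟩ + b ⟨k, i, by omega⟩) p =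
      Matrix.blockDiagonal' (fun k => jordanBlock (r k) (μ k)) p ⟨k, i + 1, hi⟩ := by
  obtain ⟨k', j⟩ := p
  by_cases hk : k' = k
  · subst hk
    by_cases hj : j = ⟨i + 1, hi⟩
    · simp [Matrix.blockDiagonal'_apply_eq, jordanBlock, hj]
    · by_cases hj' : j = ⟨i, by omega⟩
      · simp [Matrix.blockDiagonal'_apply_eq, jordanBlock, hj']
      · have : j.val ≠ i := fun h => hj' (Fin.ext h)
        simp [Matrix.blockDiagonal'_apply_eq, jordanBlock, hj, Ne.symm hj', this]
  · rw [Matrix.blockDiagonal'_apply_ne _ _ _ hk]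
    simp [Ne.symm hk]

/-- The Jordan chains of an operator in Jordan canonical form. -/
theorem HasJordanForm.exists_chains (h : HasJordanForm T r μ) :
    ∃ b : Module.Basis (Σ k, Fin (r k)) ℂ (ℂ ⊗[ℝ] V),
      (∀ k (h0 : 0 < r k), T.baseChange ℂ (b ⟨k, 0, h0⟩) = μ k • b ⟨k, 0, h0⟩) ∧
      ∀ k i (hi : i + 1 < r k), T.baseChange ℂ (b ⟨k, i + 1, hi⟩) =
        μ k • b ⟨k, i + 1, hi⟩ + b ⟨k, i, by omega⟩ := by
  obtain ⟨-, b, hb⟩ := h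
  have hrepr : ∀ q p, b.repr (T.baseChange ℂ (b q)) p =
      Matrix.blockDiagonal' (fun k => jordanBlock (r k) (μ k)) p q := fun q p => by
    rw [← hb, LinearMap.toMatrix_apply]
  exact ⟨b, fun k h0 => b.ext_elem fun p => by rw [hrepr, repr_chain_zero],
    fun k i hi => b.ext_elem fun p => by rw [hrepr, repr_chain_succ]⟩

/-- Spanning suffices because the number of vectors is the dimension. Only the values `w k i` with
`i < r k` matter. -/
theorem HasJordanForm.of_chains [FiniteDimensional ℝ V] (hr : ∀ k, 0 < r k)
    (w : Fin N → ℕ → ℂ ⊗[ℝ] V)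
    (hspan : ∀ v : V, (1 : ℂ) ⊗ₜ[ℝ] v ∈
      Submodule.span ℂ (Set.range fun p : Σ k, Fin (r k) => w p.1 p.2))
    (hcard : ∑ k, r k = Module.finrank ℝ V)
    (h0 : ∀ k, T.baseChange ℂ (w k 0) = μ k • w k 0)
    (h1 : ∀ k i, i + 1 < r k → T.baseChange ℂ (w k (i + 1)) = μ k • w k (i + 1) + w k i) :
    HasJordanForm T r μ := by
  obtain ⟨b, hbw⟩ : ∃ b : Module.Basis (Σ k, Fin (r k)) ℂ (ℂ ⊗[ℝ] V),
      ∀ k i (hi : i < r k), w k i = b ⟨k, i, hi⟩ := by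
    have htop : ⊤ ≤ Submodule.span ℂ (Set.range fun p : Σ k, Fin (r k) => w p.1 p.2) := by
      intro x _
      induction x using TensorProduct.induction_on with
      | zero => exact zero_mem _
      | tmul a v =>
        have : a ⊗ₜ[ℝ] v = a • ((1 : ℂ) ⊗ₜ[ℝ] v) := by simp [TensorProduct.smul_tmul']
        rw [this]
        exact Submodule.smul_mem _ _ (hspan v)
      | add x y hx hy => exact add_mem (hx trivial) (hy trivial)
    have hdim : Fintype.card (Σ k, Fin (r k)) = Module.finrank ℂ (ℂ ⊗[ℝ] V) := by simp [hcard]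
    exact ⟨basisOfTopLeSpanOfCardEqFinrank _ htop hdim, fun k i hi => by
      rw [coe_basisOfTopLeSpanOfCardEqFinrank]⟩
  refine ⟨hr, b, ?_⟩
  ext p ⟨k, i, hi⟩
  rw [LinearMap.toMatrix_apply, ← hbw]
  rcases i with _ | i
  · rw [h0, hbw k 0 hi, repr_chain_zero]
  · rw [h1 k i hi, hbw k (i + 1) hi, hbw k i (by omega), repr_chain_succ]

end Jordan

/-! ## The Segre type determines the class -/

section Invariants

variable {g : LinearMap.BilinForm ℝ V} {T : Module.End ℝ V} {σ : SegreType}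

/-- `T` has a time-like eigenvector. -/
def HasTimelikeEigenvector (g : LinearMap.BilinForm ℝ V) (T : Module.End ℝ V) : Prop :=
  ∃ (v : V) (a : ℝ), g v v < 0 ∧ T v = a • v

/-- `T` has a non-real eigenvalue. -/
def HasNonrealEigenvalue (T : Module.End ℝ V) : Prop :=
  ∃ (a : ℂ) (u : ℂ ⊗[ℝ] V), a.im ≠ 0 ∧ u ≠ 0 ∧ T.baseChange ℂ u = a • u

/-- `T` has a Jordan chain of length three over `ℂ`. -/
def HasLongChain (T : Module.End ℝ V) : Prop :=
  ∃ (a : ℂ) (u : ℂ ⊗[ℝ] V),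
    ((T.baseChange ℂ - algebraMap ℂ _ a : Module.End ℂ (ℂ ⊗[ℝ] V)) ^ 3) u = 0 ∧
    ((T.baseChange ℂ - algebraMap ℂ _ a : Module.End ℂ (ℂ ⊗[ℝ] V)) ^ 2) u ≠ 0

/-- The entry belongs to a non-real eigenvalue. -/
def SegreEntry.Nonreal : SegreEntry → Prop
  | .timelike => False
  | .digit _ => False
  | .z _ => True
  | .zbar _ => True

/-- The dimension of the Jordan block of a Segre entry. -/
def SegreEntry.size : SegreEntry → ℕ
  | .timelike => 1
  | .digit r => r
  | .z r => r
  | .zbar r => r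

open Classical in
theorem HasSegreType.exists_mem_join_iff (h : HasSegreType g T σ) :
    ∃ (N : ℕ) (r : Fin N → ℕ) (μ : Fin N → ℂ), HasJordanForm T r μ ∧
      ∀ e, e ∈ σ.join ↔ ∃ k, e ∈ segreGroup g T (μ k)
        ((Finset.univ.filter fun k' => μ k' = μ k).val.map r) := by
  obtain ⟨N, r, μ, hJ, rfl⟩ := h
  refine ⟨N, r, μ, hJ, fun e => ?_⟩
  simp [Multiset.mem_join]

theorem timelike_mem_segreGroup_iff {ν : ℂ} {d : Multiset ℕ} :
    SegreEntry.timelike ∈ segreGroup g T ν d ↔ ν.im = 0 ∧ ∃ v : V, g v v < 0 ∧ T v = ν.re • v := by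
  unfold segreGroup
  split_ifs with h1 h2 h3
  · simp [h1.ne']
  · simp [h2.ne]
  · simpa [show ν.im = 0 by linarith] using h3
  · simp [h3]

theorem nonreal_of_mem_segreGroup {ν : ℂ} {d : Multiset ℕ} {e : SegreEntry}
    (he : e ∈ segreGroup g T ν d) : e.Nonreal ↔ ν.im ≠ 0 := by
  unfold segreGroup at he
  split_ifs at he with h1 h2 h3
  · obtain ⟨x, -, rfl⟩ := Multiset.mem_map.1 he
    simp [SegreEntry.Nonreal, h1.ne']
  · obtain ⟨x, -, rfl⟩ := Multiset.mem_map.1 he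
    simp [SegreEntry.Nonreal, h2.ne]
  · have : ν.im = 0 := by linarith
    rcases Multiset.mem_cons.1 he with rfl | he
    · simp [SegreEntry.Nonreal, this]
    · obtain ⟨x, -, rfl⟩ := Multiset.mem_map.1 he
      simp [SegreEntry.Nonreal, this]
  · have : ν.im = 0 := by linarith
    obtain ⟨x, -, rfl⟩ := Multiset.mem_map.1 he
    simp [SegreEntry.Nonreal, this]

/-- The bound excludes `timelike`, which is put into the group without regard to `d`. -/
theorem size_mem_of_mem_segreGroup {ν : ℂ} {d : Multiset ℕ} {e : SegreEntry}
    (he : e ∈ segreGroup g T ν d) (h2 : 2 ≤ e.size) : e.size ∈ d := by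
  unfold segreGroup at he
  split_ifs at he
  · obtain ⟨x, hx, rfl⟩ := Multiset.mem_map.1 he
    exact hx
  · obtain ⟨x, hx, rfl⟩ := Multiset.mem_map.1 he
    exact hx
  · rcases Multiset.mem_cons.1 he with rfl | he
    · simp [SegreEntry.size] at h2
    · obtain ⟨x, hx, rfl⟩ := Multiset.mem_map.1 he
      exact Multiset.mem_of_mem_erase hx
  · obtain ⟨x, hx, rfl⟩ := Multiset.mem_map.1 he
    exact hx

/-- Only a block of size one with real eigenvalue can be erased in favour of `timelike`, whence the
alternative. -/
theorem exists_mem_segreGroup {ν : ℂ} {d : Multiset ℕ} {s : ℕ} (hs : s ∈ d)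
    (h2 : ν.im ≠ 0 ∨ 2 ≤ s) : ∃ e ∈ segreGroup g T ν d, e.size = s := by
  unfold segreGroup
  split_ifs with hpos hneg htl
  · exact ⟨_, Multiset.mem_map_of_mem _ hs, rfl⟩
  · exact ⟨_, Multiset.mem_map_of_mem _ hs, rfl⟩
  · have h2 : 2 ≤ s := h2.resolve_left (not_not.2 (by linarith))
    exact ⟨_, Multiset.mem_cons_of_mem (Multiset.mem_map_of_mem _
      ((Multiset.mem_erase_of_ne (by omega)).2 hs)), rfl⟩
  · exact ⟨_, Multiset.mem_map_of_mem _ hs, rfl⟩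

theorem one_tmul_ne_zero {v : V} (hv : v ≠ 0) : (1 : ℂ) ⊗ₜ[ℝ] v ≠ 0 := fun h =>
  hv (Module.FaithfullyFlat.tensorProduct_mk_injective (A := ℝ) (B := ℂ) V (by simpa using h))

theorem HasSegreType.timelike_mem_join_iff (h : HasSegreType g T σ) :
    SegreEntry.timelike ∈ σ.join ↔ HasTimelikeEigenvector g T := by
  obtain ⟨N, r, μ, hJ, hmem⟩ := h.exists_mem_join_iff
  simp only [hmem, timelike_mem_segreGroup_iff]
  constructor
  · rintro ⟨k, -, v, hv, hTv⟩
    exact ⟨v, _, hv, hTv⟩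
  · rintro ⟨v, a, hv, hTv⟩
    have hv0 : v ≠ 0 := by rintro rfl; simp at hv
    obtain ⟨k, hk⟩ := hJ.mem_range_of_eigenvector (a := a) (one_tmul_ne_zero hv0) (by
      rw [LinearMap.baseChange_tmul, hTv, TensorProduct.smul_tmul', TensorProduct.tmul_smul,
        TensorProduct.smul_tmul']
      simp)
    exact ⟨k, by simp [hk], v, hv, by simpa [hk] using hTv⟩

theorem HasSegreType.nonreal_mem_join_iff (h : HasSegreType g T σ) :
    (∃ e ∈ σ.join, e.Nonreal) ↔ HasNonrealEigenvalue T := by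
  obtain ⟨N, r, μ, hJ, hmem⟩ := h.exists_mem_join_iff
  simp only [hmem]
  constructor
  · rintro ⟨e, ⟨k, hk⟩, he⟩
    obtain ⟨b, hb, -⟩ := hJ.exists_chains
    exact ⟨μ k, _, (nonreal_of_mem_segreGroup hk).1 he, b.ne_zero _, hb k (hJ.1 k)⟩
  · rintro ⟨a, u, ha, hu0, hu⟩
    obtain ⟨k, rfl⟩ := hJ.mem_range_of_eigenvector hu0 hu
    obtain ⟨e, he, -⟩ := exists_mem_segreGroup (g := g) (T := T) (ν := μ k) (s := r k)
      (d := (Finset.univ.filter fun k' => μ k' = μ k).val.map r)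
      (Multiset.mem_map_of_mem _ (by simp)) (Or.inl ha)
    exact ⟨e, ⟨k, he⟩, (nonreal_of_mem_segreGroup he).2 ha⟩

theorem HasSegreType.three_le_size_mem_join_iff (h : HasSegreType g T σ) :
    (∃ e ∈ σ.join, 3 ≤ e.size) ↔ HasLongChain T := by
  obtain ⟨N, r, μ, hJ, hmem⟩ := h.exists_mem_join_iff
  simp only [hmem]
  constructor
  · rintro ⟨e, ⟨k, hk⟩, he⟩
    obtain ⟨b, hb0, hb1⟩ := hJ.exists_chains
    obtain ⟨k', hk', hr⟩ := Multiset.mem_map.1 (size_mem_of_mem_segreGroup hk (by omega))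
    have h2 := hb1 k' 1 (by omega)
    have h1 := hb1 k' 0 (by omega)
    have h0 := hb0 k' (by omega)
    simp only [zero_add, Nat.reduceAdd] at h1 h2
    refine ⟨μ k', b ⟨k', 2, by omega⟩, ?_, ?_⟩
    · simp [pow_succ, h0, h1, h2]
    · simpa [pow_succ, h0, h1, h2] using b.ne_zero _
  · rintro ⟨a, u, hu3, hu2⟩
    obtain ⟨k, hk, hr⟩ : ∃ k, μ k = a ∧ 2 < r k := by
      by_contra! hcon
      exact hu2 (hJ.pow_apply_eq_zero a 2 (fun k => or_iff_not_imp_left.2 fun h =>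
        hcon k (not_not.1 h)) hu3)
    obtain ⟨e, he, hes⟩ := exists_mem_segreGroup (g := g) (T := T) (ν := μ k) (s := r k)
      (d := (Finset.univ.filter fun k' => μ k' = μ k).val.map r)
      (Multiset.mem_map_of_mem _ (by simp)) (Or.inr (by omega))
    exact ⟨e, ⟨k, he⟩, by omega⟩

theorem SegreClass.timelike_mem_entries_iff (n : ℕ) (c : SegreClass) :
    SegreEntry.timelike ∈ c.entries n ↔ c = .one := by
  cases c <;> simp [SegreClass.entries, Multiset.mem_replicate]

theorem SegreClass.nonreal_mem_entries_iff (n : ℕ) (c : SegreClass) :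
    (∃ e ∈ c.entries n, e.Nonreal) ↔ c = .complex := by
  cases c <;> simp [SegreClass.entries, Multiset.mem_replicate, SegreEntry.Nonreal]

theorem SegreClass.three_le_size_mem_entries_iff (n : ℕ) (c : SegreClass) :
    (∃ e ∈ c.entries n, 3 ≤ e.size) ↔ c = .three := by
  cases c <;> simp [SegreClass.entries, Multiset.mem_replicate, SegreEntry.size]

/-- The three properties of the entries are equivalent to properties of `T` alone, so they do not
depend on the Jordan form behind `σ` or `σ'`. -/
theorem SegreClass.eq_of_hasSegreType {n : ℕ} {c c' : SegreClass} {σ' : SegreType}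
    (h : HasSegreType g T σ) (hc : IsDegeneracyOf σ (c.entries n))
    (h' : HasSegreType g T σ') (hc' : IsDegeneracyOf σ' (c'.entries n)) : c = c' := by
  have h1 := h.timelike_mem_join_iff.trans h'.timelike_mem_join_iff.symm
  have h2 := h.nonreal_mem_join_iff.trans h'.nonreal_mem_join_iff.symm
  have h3 := h.three_le_size_mem_join_iff.trans h'.three_le_size_mem_join_iff.symm
  rw [hc.1, hc'.1] at h1 h2 h3
  rw [SegreClass.timelike_mem_entries_iff, SegreClass.timelike_mem_entries_iff] at h1
  rw [SegreClass.nonreal_mem_entries_iff, SegreClass.nonreal_mem_entries_iff] at h2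
  rw [SegreClass.three_le_size_mem_entries_iff, SegreClass.three_le_size_mem_entries_iff] at h3
  cases c <;> cases c' <;> simp_all

end Invariants

/-! ## The Segre types of the canonical forms -/

section SegreOfCanonical

variable {g : LinearMap.BilinForm ℝ V} {T : Module.End ℝ V}

open Classical in
/-- The join of the Segre type, when the group of each eigenvalue is given by a labelling of the
Jordan blocks. -/
theorem HasJordanForm.exists_hasSegreType {N : ℕ} {r : Fin N → ℕ} {μ : Fin N → ℂ}
    (h : HasJordanForm T r μ) (f : Fin N → SegreEntry)
    (hf : ∀ k, segreGroup g T (μ k) ((Finset.univ.filter fun k' => μ k' = μ k).val.map r) =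
      (Finset.univ.filter fun k' => μ k' = μ k).val.map f) :
    ∃ σ, HasSegreType g T σ ∧ IsDegeneracyOf σ (Finset.univ.val.map f) := by
  have hcongr : ((Finset.univ.image μ).val.map fun ν =>
      segreGroup g T ν ((Finset.univ.filter fun k => μ k = ν).val.map r)) =
      (Finset.univ.image μ).val.map fun ν => (Finset.univ.filter fun k => μ k = ν).val.map f := by
    refine Multiset.map_congr rfl fun ν hν => ?_
    obtain ⟨k, -, rfl⟩ := Finset.mem_image.1 (Finset.mem_def.2 hν)
    exact hf k
  refine ⟨_, ⟨N, r, μ, h, rfl⟩, ?_, ?_⟩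
  · rw [hcongr]
    -- The join is a sum over eigenvalues of sums over the fibres of `μ`.
    have := Finset.sum_fiberwise_of_maps_to (s := Finset.univ) (t := Finset.univ.image μ)
      (g := μ) (fun k hk => Finset.mem_image_of_mem μ hk) fun k => ({f k} : Multiset SegreEntry)
    simp only [Finset.sum] at this
    have hsing : ∀ s : Multiset (Fin N),
        (s.map fun k => ({f k} : Multiset SegreEntry)).sum = s.map f := fun s => by
      rw [← Multiset.sum_map_singleton (s.map f), Multiset.map_map]
      rfl
    simp only [hsing] at this
    exact this
  · rw [hcongr]
    intro h0
    obtain ⟨ν, hν, h0⟩ := Multiset.mem_map.1 h0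
    obtain ⟨k, -, rfl⟩ := Finset.mem_image.1 (Finset.mem_def.2 hν)
    have h1 : f k ∈ (Finset.univ.filter fun k' => μ k' = μ k).val.map f :=
      Multiset.mem_map_of_mem _ (by simp)
    rw [h0] at h1
    exact Multiset.notMem_zero _ h1

/-- The entry of a block in the absence of time-like eigenvectors. -/
noncomputable def blockEntry (ν : ℂ) (d : ℕ) : SegreEntry :=
  if 0 < ν.im then .z d else if ν.im < 0 then .zbar d else .digit d

theorem HasJordanForm.exists_hasSegreType_of_not_timelike {N : ℕ} {r : Fin N → ℕ}
    {μ : Fin N → ℂ} (h : HasJordanForm T r μ) (hT : ¬ HasTimelikeEigenvector g T) :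
    ∃ σ, HasSegreType g T σ ∧
      IsDegeneracyOf σ (Finset.univ.val.map fun k => blockEntry (μ k) (r k)) := by
  classical
  refine h.exists_hasSegreType _ fun k => ?_
  have hnot : ¬ ∃ v : V, g v v < 0 ∧ T v = (μ k).re • v := fun ⟨v, hv, hTv⟩ => hT ⟨v, _, hv, hTv⟩
  have hmap : (Finset.univ.filter fun k' => μ k' = μ k).val.map
      (fun k' => blockEntry (μ k') (r k')) =
      ((Finset.univ.filter fun k' => μ k' = μ k).val.map r).map (blockEntry (μ k)) := by
    rw [Multiset.map_map]
    refine Multiset.map_congr rfl fun k' hk' => ?_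
    rw [(Finset.mem_filter.1 (Finset.mem_def.2 hk')).2]
    rfl
  rw [hmap]
  unfold segreGroup blockEntry
  split_ifs <;> rfl

theorem univ_val_map_fin_succ {α : Type*} {N : ℕ} (f : Fin (N + 1) → α) :
    Finset.univ.val.map f = f 0 ::ₘ Finset.univ.val.map fun i : Fin N => f i.succ := by
  rw [Fin.univ_val_map, Fin.univ_val_map, List.ofFn_succ]
  rfl

namespace SemiNullBasis

variable {k : ℕ} (B : SemiNullBasis g k)

theorem one_tmul_mem {S : Submodule ℂ (ℂ ⊗[ℝ] V)} (hl : (1 : ℂ) ⊗ₜ[ℝ] B.l ∈ S)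
    (hm : (1 : ℂ) ⊗ₜ[ℝ] B.m ∈ S) (hx : ∀ i, (1 : ℂ) ⊗ₜ[ℝ] B.x i ∈ S) (v : V) :
    (1 : ℂ) ⊗ₜ[ℝ] v ∈ S := by
  have hv : v ∈ Submodule.span ℝ (Set.range (Sum.elim ![B.l, B.m] B.x)) := by
    rw [B.span_eq_top]; trivial
  induction hv using Submodule.span_induction with
  | mem y hy =>
    obtain ⟨i | i, rfl⟩ := hy
    · fin_cases i
      · exact hl
      · exact hm
    · exact hx i
  | zero => simp
  | add y z _ _ hy hz => rw [TensorProduct.tmul_add]; exact add_mem hy hz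
  | smul a y _ hy =>
    have : (1 : ℂ) ⊗ₜ[ℝ] (a • y) = (a : ℂ) • ((1 : ℂ) ⊗ₜ[ℝ] y) := by
      rw [TensorProduct.tmul_smul, TensorProduct.smul_tmul', TensorProduct.smul_tmul']
      simp
    rw [this]
    exact S.smul_mem _ hy

theorem l_ne_zero : B.l ≠ 0 := fun h => by
  have := B.l_m
  simp [h] at this

/-- A time-like vector cannot be orthogonal to the nonzero null vector `l`. -/
theorem not_hasTimelikeEigenvector_of (hs : ∀ u v, g u v = g v u) (hp : PosOnHyperplane g)
    (h : ∀ (v : V) (a : ℝ), T v = a • v → g B.l v = 0) : ¬ HasTimelikeEigenvector g T := by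
  rintro ⟨v, a, hv, hTv⟩
  exact (hp.pos_of_orthogonal_timelike hs hv ((hs _ _).trans (h v a hTv)) B.l_ne_zero).ne' B.l_l

theorem finrank_eq (B : SemiNullBasis g k) : Module.finrank ℝ V = k + 2 := by
  have := Module.finrank_eq_card_basis (Module.Basis.mk B.linearIndependent B.span_eq_top.ge)
  rw [this]
  simp [add_comm]

theorem not_hasTimelikeEigenvector (hs : ∀ u v, g u v = g v u) (hp : PosOnHyperplane g)
    (hT : ∀ u v, g (T u) v = g u (T v)) {c : SegreClass} (hc : B.CanonicalAction T c)
    (h1 : c ≠ .one) : ¬ HasTimelikeEigenvector g T := by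
  refine B.not_hasTimelikeEigenvector_of hs hp fun v a hv => ?_
  have hpair : ∀ w, g (T w) v = a * g w v := fun w => by rw [hT, hv]; simp
  have hl := hpair B.l
  have hm := hpair B.m
  cases c with
  | one => exact absurd rfl h1
  | two =>
    obtain ⟨ρ₁, ε, ρ, hε, hTl, hTm, -⟩ := hc
    rw [hTl] at hl
    rw [hTm] at hm
    simp at hl hm
    rcases hl with rfl | h
    · rcases hε with rfl | rfl <;> linarith
    · exact h
  | three =>
    obtain ⟨ρ₁, ρ, i, -, hρ, hTl, hTm, hTx⟩ := hc
    have hx := hpair (B.x i)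
    rw [hTl] at hl
    rw [hTx, hρ] at hx
    simp at hl hx
    rcases hl with rfl | h
    · linarith
    · exact h
  | complex =>
    obtain ⟨ρ₁, ρ₂, ρ, hρ, hTl, hTm, -⟩ := hc
    rw [hTl] at hl
    rw [hTm] at hm
    simp at hl hm
    -- The pairings with `l` and `m` form a homogeneous linear system with this determinant.
    have h : ((a - ρ₁) ^ 2 + ρ₂ ^ 2) * g B.l v = 0 := by
      linear_combination -(a - ρ₁) * hl + ρ₂ * hm
    have hpos : (a - ρ₁) ^ 2 + ρ₂ ^ 2 ≠ 0 := by positivity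
    exact (mul_eq_zero.1 h).resolve_left hpos

theorem baseChange_one_tmul (v : V) : T.baseChange ℂ ((1 : ℂ) ⊗ₜ[ℝ] v) = 1 ⊗ₜ[ℝ] T v := by simp

theorem ofReal_smul_one_tmul (a : ℝ) (v : V) :
    (a : ℂ) • ((1 : ℂ) ⊗ₜ[ℝ] v) = 1 ⊗ₜ[ℝ] (a • v) := by
  rw [TensorProduct.tmul_smul, TensorProduct.smul_tmul', TensorProduct.smul_tmul']
  simp

/-- The first `x` is excluded because in the third form it belongs to the Jordan chain. -/
theorem apply_x_of_canonicalAction {c : SegreClass} (hc : B.CanonicalAction T c) (i : Fin k)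
    (hi : i.val ≠ 0) : ∃ η : ℝ, T (B.x i) = η • B.x i := by
  cases c with
  | one =>
    obtain ⟨_, _, ρ, -, -, hTx⟩ := hc
    exact ⟨_, hTx i⟩
  | two =>
    obtain ⟨_, _, ρ, -, -, -, hTx⟩ := hc
    exact ⟨_, hTx i⟩
  | three =>
    obtain ⟨_, ρ, i₁, hi₁, -, -, -, hTx⟩ := hc
    refine ⟨ρ i, ?_⟩
    rw [hTx, if_neg (by rintro rfl; exact hi hi₁), zero_add]
  | complex =>
    obtain ⟨_, _, ρ, -, -, -, hTx⟩ := hc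
    exact ⟨_, hTx i⟩

variable [FiniteDimensional ℝ V]

theorem exists_hasSegreType_one (hs : ∀ u v, g u v = g v u) (hp : PosOnHyperplane g)
    (hT : ∀ u v, g (T u) v = g u (T v)) (hc : B.CanonicalAction T .one) :
    ∃ σ, HasSegreType g T σ ∧ IsDegeneracyOf σ (SegreClass.one.entries (k + 2)) := by
  classical
  obtain ⟨ρ₁, ρ₂, ρ, hTl, hTm, hTx⟩ := hc
  have hTt : T (B.l - B.m) = (ρ₁ - ρ₂) • (B.l - B.m) := by rw [map_sub, hTl, hTm]; module
  have hTs : T (B.l + B.m) = (ρ₁ + ρ₂) • (B.l + B.m) := by rw [map_add, hTl, hTm]; module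
  have hneg : g (B.l - B.m) (B.l - B.m) < 0 := by
    simp [B.l_l, B.m_m, B.l_m, B.m_l]
  -- Eigenvectors for distinct eigenvalues are orthogonal, and two time-like vectors never are; so
  -- exactly one group contains `timelike`.
  have huniq : ∀ a : ℝ, (∃ v, g v v < 0 ∧ T v = a • v) → a = ρ₁ - ρ₂ := by
    rintro a ⟨v, hv, hTv⟩
    by_contra hne
    have h0 : g (B.l - B.m) v = 0 := by
      have := hT (B.l - B.m) v
      rw [hTt, hTv, map_smul, map_smul, LinearMap.smul_apply, smul_eq_mul, smul_eq_mul] at this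
      have h : (a - (ρ₁ - ρ₂)) * g (B.l - B.m) v = 0 := by linarith
      exact (mul_eq_zero.1 h).resolve_left (sub_ne_zero.2 hne)
    have := hp.pos_of_orthogonal_timelike hs hneg h0 (by rintro rfl; simp at hv)
    linarith
  let e : Fin (k + 2) → V := Fin.cons (B.l - B.m) (Fin.cons (B.l + B.m) B.x)
  let ν : Fin (k + 2) → ℝ := Fin.cons (ρ₁ - ρ₂) (Fin.cons (ρ₁ + ρ₂) ρ)
  have he : ∀ i, T (e i) = ν i • e i := by
    intro i
    cases i using Fin.cases with
    | zero => exact hTt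
    | succ i =>
      cases i using Fin.cases with
      | zero => exact hTs
      | succ i => exact hTx i
  have hJ : HasJordanForm T (fun _ : Fin (k + 2) => 1) fun i => (ν i : ℂ) := by
    refine HasJordanForm.of_chains (fun _ => one_pos) (fun i _ => (1 : ℂ) ⊗ₜ[ℝ] e i) ?_ ?_ ?_ ?_
    · set S := Submodule.span ℂ (Set.range fun p : Σ _ : Fin (k + 2), Fin 1 =>
        (1 : ℂ) ⊗ₜ[ℝ] e p.1)
      have hmem : ∀ i, (1 : ℂ) ⊗ₜ[ℝ] e i ∈ S := fun i => Submodule.subset_span ⟨⟨i, 0⟩, rfl⟩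
      have h0 : (1 : ℂ) ⊗ₜ[ℝ] (B.l - B.m) ∈ S := hmem 0
      have h1 : (1 : ℂ) ⊗ₜ[ℝ] (B.l + B.m) ∈ S := hmem (Fin.succ 0)
      refine B.one_tmul_mem ?_ ?_ fun i => hmem i.succ.succ
      · have := S.smul_mem (1 / 2 : ℂ) (add_mem h1 h0)
        rw [TensorProduct.tmul_sub, TensorProduct.tmul_add] at this
        convert this using 1
        module
      · have := S.smul_mem (1 / 2 : ℂ) (sub_mem h1 h0)
        rw [TensorProduct.tmul_sub, TensorProduct.tmul_add] at this
        convert this using 1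
        module
    · simp [B.finrank_eq]
    · intro i
      rw [baseChange_one_tmul, he, ofReal_smul_one_tmul]
    · intro i j hj
      omega
  obtain ⟨σ, h1, h2⟩ := hJ.exists_hasSegreType (g := g)
    (Fin.cons .timelike fun _ => .digit 1) (by
      intro i
      unfold segreGroup
      rw [if_neg (by simp), if_neg (by simp)]
      by_cases hi : (ν i : ℂ) = ν 0
      · have hi' : ν i = ρ₁ - ρ₂ := Complex.ofReal_injective hi
        rw [if_pos ⟨_, hneg, by rw [Complex.ofReal_re, hi', hTt]⟩]
        -- In the group of the time-like eigenvalue, the erased digit is that of block `0`, the one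
        -- labelled `timelike`.
        set s := (Finset.univ.filter fun k' => (ν k' : ℂ) = ν i) with hsdef
        have h0 : (0 : Fin (k + 2)) ∈ s := by simp [hsdef, hi]
        obtain ⟨t, ht⟩ := Multiset.exists_cons_of_mem (Finset.mem_def.1 h0)
        have h0t : 0 ∉ t := by
          have := s.nodup
          rw [ht, Multiset.nodup_cons] at this
          exact this.1
        rw [ht, Multiset.map_cons, Multiset.map_cons, Multiset.erase_cons_head, Multiset.map_map]
        congr 1
        refine Multiset.map_congr rfl fun j hj => ?_
        cases j using Fin.cases with
        | zero => exact absurd hj h0t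
        | succ j => rfl
      · have hno : ¬ ∃ v, g v v < 0 ∧ T v = (ν i : ℂ).re • v := fun h =>
          hi (congrArg Complex.ofReal (huniq (ν i) h))
        rw [if_neg hno, Multiset.map_map]
        refine Multiset.map_congr rfl fun j hj => ?_
        have hj := (Finset.mem_filter.1 (Finset.mem_def.2 hj)).2
        cases j using Fin.cases with
        | zero => exact absurd hj.symm hi
        | succ j => rfl)
  refine ⟨σ, h1, ?_⟩
  rw [univ_val_map_fin_succ] at h2
  simpa [SegreClass.entries] using h2

theorem blockEntry_ofReal (a : ℝ) (d : ℕ) : blockEntry (a : ℂ) d = .digit d := by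
  simp [blockEntry]

theorem exists_hasSegreType_two (hT : ¬ HasTimelikeEigenvector g T)
    (hc : B.CanonicalAction T .two) :
    ∃ σ, HasSegreType g T σ ∧ IsDegeneracyOf σ (SegreClass.two.entries (k + 2)) := by
  obtain ⟨ρ₁, ε, ρ, hε, hTl, hTm, hTx⟩ := hc
  have hεε : ε * ε = 1 := by rcases hε with rfl | rfl <;> norm_num
  -- The chain ends in `ε • l`, the image of `m` under `T - ρ₁`.
  let w : Fin (k + 1) → ℕ → ℂ ⊗[ℝ] V :=
    Fin.cons (fun i => if i = 0 then 1 ⊗ₜ (ε • B.l) else 1 ⊗ₜ B.m) fun j _ => 1 ⊗ₜ B.x j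
  have hJ : HasJordanForm T (Fin.cons 2 fun _ => 1 : Fin (k + 1) → ℕ)
      (Fin.cons (ρ₁ : ℂ) fun i => (ρ i : ℂ)) := by
    refine HasJordanForm.of_chains ?_ w ?_ ?_ ?_ ?_
    · intro i
      cases i using Fin.cases <;> simp
    · set S := Submodule.span ℂ (Set.range fun p :
        Σ i, Fin ((Fin.cons 2 fun _ => 1 : Fin (k + 1) → ℕ) i) => w p.1 p.2)
      have h0 : (1 : ℂ) ⊗ₜ[ℝ] (ε • B.l) ∈ S :=
        Submodule.subset_span ⟨⟨0, (0 : Fin 2)⟩, rfl⟩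
      refine B.one_tmul_mem ?_ (Submodule.subset_span ⟨⟨0, (1 : Fin 2)⟩, rfl⟩)
        fun i => Submodule.subset_span ⟨⟨i.succ, (0 : Fin 1)⟩, rfl⟩
      have := S.smul_mem (ε : ℂ) h0
      rwa [ofReal_smul_one_tmul, smul_smul, hεε, one_smul] at this
    · simp [Fin.sum_univ_succ, B.finrank_eq]; omega
    · intro i
      cases i using Fin.cases with
      | zero =>
        change T.baseChange ℂ (1 ⊗ₜ (ε • B.l)) = (ρ₁ : ℂ) • (1 : ℂ) ⊗ₜ[ℝ] (ε • B.l)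
        rw [baseChange_one_tmul, ofReal_smul_one_tmul, map_smul, hTl, smul_comm]
      | succ i =>
        change T.baseChange ℂ (1 ⊗ₜ B.x i) = (ρ i : ℂ) • (1 : ℂ) ⊗ₜ[ℝ] B.x i
        rw [baseChange_one_tmul, ofReal_smul_one_tmul, hTx]
    · intro i j hj
      cases i using Fin.cases with
      | zero =>
        have hj : j + 1 < 2 := hj
        obtain rfl : j = 0 := by omega
        change T.baseChange ℂ (1 ⊗ₜ B.m) = (ρ₁ : ℂ) • (1 : ℂ) ⊗ₜ[ℝ] B.m + 1 ⊗ₜ (ε • B.l)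
        rw [baseChange_one_tmul, ofReal_smul_one_tmul, hTm, ← TensorProduct.tmul_add, add_comm]
      | succ i => simp at hj
  obtain ⟨σ, h1, h2⟩ := hJ.exists_hasSegreType_of_not_timelike hT
  refine ⟨σ, h1, ?_⟩
  rw [univ_val_map_fin_succ] at h2
  simpa [SegreClass.entries, blockEntry_ofReal] using h2

theorem exists_hasSegreType_three {k : ℕ} (B : SemiNullBasis g (k + 1))
    (hT : ¬ HasTimelikeEigenvector g T) (hc : B.CanonicalAction T .three) :
    ∃ σ, HasSegreType g T σ ∧ IsDegeneracyOf σ (SegreClass.three.entries (k + 3)) := by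
  obtain ⟨ρ₁, ρ, i₁, hi₁, hρ, hTl, hTm, hTx⟩ := hc
  obtain rfl : i₁ = 0 := Fin.ext hi₁
  let w : Fin (k + 1) → ℕ → ℂ ⊗[ℝ] V :=
    Fin.cons (fun i => if i = 0 then 1 ⊗ₜ B.l else if i = 1 then 1 ⊗ₜ B.x 0 else 1 ⊗ₜ B.m)
      fun j _ => 1 ⊗ₜ B.x j.succ
  have hJ : HasJordanForm T (Fin.cons 3 fun _ => 1 : Fin (k + 1) → ℕ)
      (fun i => (ρ i : ℂ)) := by
    refine HasJordanForm.of_chains ?_ w ?_ ?_ ?_ ?_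
    · intro i
      cases i using Fin.cases <;> simp
    · refine B.one_tmul_mem (Submodule.subset_span ⟨⟨0, (0 : Fin 3)⟩, rfl⟩)
        (Submodule.subset_span ⟨⟨0, (2 : Fin 3)⟩, rfl⟩) fun i => ?_
      cases i using Fin.cases with
      | zero => exact Submodule.subset_span ⟨⟨0, (1 : Fin 3)⟩, rfl⟩
      | succ i => exact Submodule.subset_span ⟨⟨i.succ, (0 : Fin 1)⟩, rfl⟩
    · simp [Fin.sum_univ_succ, B.finrank_eq]; omega
    · intro i
      cases i using Fin.cases with
      | zero =>
        change T.baseChange ℂ (1 ⊗ₜ B.l) = (ρ 0 : ℂ) • (1 : ℂ) ⊗ₜ[ℝ] B.l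
        rw [baseChange_one_tmul, ofReal_smul_one_tmul, hTl, hρ]
      | succ i =>
        change T.baseChange ℂ (1 ⊗ₜ B.x i.succ) = (ρ i.succ : ℂ) • (1 : ℂ) ⊗ₜ[ℝ] B.x i.succ
        rw [baseChange_one_tmul, ofReal_smul_one_tmul, hTx, if_neg (Fin.succ_ne_zero i), zero_add]
    · intro i j hj
      cases i using Fin.cases with
      | zero =>
        have hj : j + 1 < 3 := hj
        obtain rfl | rfl : j = 0 ∨ j = 1 := by omega
        · change T.baseChange ℂ (1 ⊗ₜ B.x 0) = (ρ 0 : ℂ) • (1 : ℂ) ⊗ₜ[ℝ] B.x 0 + 1 ⊗ₜ B.l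
          rw [baseChange_one_tmul, ofReal_smul_one_tmul, hTx, if_pos rfl,
            ← TensorProduct.tmul_add, add_comm]
        · change T.baseChange ℂ (1 ⊗ₜ B.m) = (ρ 0 : ℂ) • (1 : ℂ) ⊗ₜ[ℝ] B.m + 1 ⊗ₜ B.x 0
          rw [baseChange_one_tmul, ofReal_smul_one_tmul, hTm, hρ, ← TensorProduct.tmul_add,
            add_comm]
      | succ i => simp at hj
  obtain ⟨σ, h1, h2⟩ := hJ.exists_hasSegreType_of_not_timelike hT
  refine ⟨σ, h1, ?_⟩
  rw [univ_val_map_fin_succ] at h2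
  simpa [SegreClass.entries, blockEntry_ofReal] using h2

theorem exists_hasSegreType_complex (hT : ¬ HasTimelikeEigenvector g T)
    (hc : B.CanonicalAction T .complex) :
    ∃ σ, HasSegreType g T σ ∧ IsDegeneracyOf σ (SegreClass.complex.entries (k + 2)) := by
  obtain ⟨ρ₁, ρ₂, ρ, hρ, hTl, hTm, hTx⟩ := hc
  -- `l ± i m` are eigenvectors for `ρ₁ ± i ρ₂`.
  let e : Fin (k + 2) → ℂ ⊗[ℝ] V :=
    Fin.cons (1 ⊗ₜ B.l + Complex.I • 1 ⊗ₜ B.m)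
      (Fin.cons (1 ⊗ₜ B.l - Complex.I • 1 ⊗ₜ B.m) fun i => 1 ⊗ₜ B.x i)
  have hl : T.baseChange ℂ ((1 : ℂ) ⊗ₜ[ℝ] B.l) =
      (ρ₁ : ℂ) • 1 ⊗ₜ[ℝ] B.l - (ρ₂ : ℂ) • 1 ⊗ₜ[ℝ] B.m := by
    rw [baseChange_one_tmul, hTl, ofReal_smul_one_tmul, ofReal_smul_one_tmul,
      TensorProduct.tmul_sub]
  have hm : T.baseChange ℂ ((1 : ℂ) ⊗ₜ[ℝ] B.m) =
      (ρ₂ : ℂ) • 1 ⊗ₜ[ℝ] B.l + (ρ₁ : ℂ) • 1 ⊗ₜ[ℝ] B.m := by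
    rw [baseChange_one_tmul, hTm, ofReal_smul_one_tmul, ofReal_smul_one_tmul,
      TensorProduct.tmul_add]
  have hJ : HasJordanForm T (fun _ : Fin (k + 2) => 1)
      (Fin.cons (⟨ρ₁, ρ₂⟩ : ℂ) (Fin.cons (⟨ρ₁, -ρ₂⟩ : ℂ) fun i => (ρ i : ℂ))) := by
    refine HasJordanForm.of_chains (fun _ => one_pos) (fun i _ => e i) ?_ ?_ ?_ ?_
    · set S := Submodule.span ℂ (Set.range fun p : Σ _ : Fin (k + 2), Fin 1 => e p.1)
      have hmem : ∀ i, e i ∈ S := fun i => Submodule.subset_span ⟨⟨i, 0⟩, rfl⟩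
      have h0 : (1 : ℂ) ⊗ₜ[ℝ] B.l + Complex.I • (1 : ℂ) ⊗ₜ[ℝ] B.m ∈ S := hmem 0
      have h1 : (1 : ℂ) ⊗ₜ[ℝ] B.l - Complex.I • (1 : ℂ) ⊗ₜ[ℝ] B.m ∈ S := hmem (Fin.succ 0)
      refine B.one_tmul_mem ?_ ?_ fun i => hmem i.succ.succ
      · have := S.smul_mem (1 / 2 : ℂ) (add_mem h0 h1)
        convert this using 1
        module
      · have := S.smul_mem (-Complex.I / 2 : ℂ) (sub_mem h0 h1)
        convert this using 1
        match_scalars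
        · linear_combination Complex.I_mul_I
        · ring
    · simp [B.finrank_eq]
    · intro i
      have hz : ∀ a b : ℝ, (⟨a, b⟩ : ℂ) = a + b * Complex.I := fun a b => Complex.mk_eq_add_mul_I a b
      cases i using Fin.cases with
      | zero =>
        change T.baseChange ℂ (1 ⊗ₜ B.l + Complex.I • 1 ⊗ₜ B.m) =
          (⟨ρ₁, ρ₂⟩ : ℂ) • (1 ⊗ₜ B.l + Complex.I • 1 ⊗ₜ B.m)
        rw [map_add, map_smul, hl, hm, hz]
        match_scalars
        · ring
        · linear_combination (-ρ₂ : ℂ) * Complex.I_mul_I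
      | succ i =>
        cases i using Fin.cases with
        | zero =>
          change T.baseChange ℂ (1 ⊗ₜ B.l - Complex.I • 1 ⊗ₜ B.m) =
            (⟨ρ₁, -ρ₂⟩ : ℂ) • (1 ⊗ₜ B.l - Complex.I • 1 ⊗ₜ B.m)
          rw [map_sub, map_smul, hl, hm, hz]
          match_scalars
          · ring
          · linear_combination (-ρ₂ : ℂ) * Complex.I_mul_I
        | succ i =>
          change T.baseChange ℂ (1 ⊗ₜ B.x i) = (ρ i : ℂ) • (1 : ℂ) ⊗ₜ[ℝ] B.x i
          rw [baseChange_one_tmul, ofReal_smul_one_tmul, hTx]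
    · intro i j hj
      omega
  obtain ⟨σ, h1, h2⟩ := hJ.exists_hasSegreType_of_not_timelike hT
  refine ⟨σ, h1, ?_⟩
  rw [univ_val_map_fin_succ, univ_val_map_fin_succ] at h2
  -- The sign of `ρ₂` decides which of the two conjugate blocks is `z`.
  rcases lt_or_gt_of_ne hρ with h | h
  · rw [Multiset.cons_swap] at h2
    simpa [SegreClass.entries, blockEntry, h, h.le, h.not_gt] using h2
  · simpa [SegreClass.entries, blockEntry, h, h.le, h.not_gt] using h2

theorem exists_hasSegreType {k : ℕ} (B : SemiNullBasis g (k + 1)) (hs : ∀ u v, g u v = g v u)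
    (hp : PosOnHyperplane g) (hT : ∀ u v, g (T u) v = g u (T v)) {c : SegreClass}
    (hc : B.CanonicalAction T c) :
    ∃ σ, HasSegreType g T σ ∧ IsDegeneracyOf σ (c.entries (k + 3)) := by
  have hn := B.not_hasTimelikeEigenvector hs hp hT hc
  cases c with
  | one => exact B.exists_hasSegreType_one hs hp hT hc
  | two => exact B.exists_hasSegreType_two (hn (by simp)) hc
  | three => exact B.exists_hasSegreType_three (hn (by simp)) hc
  | complex => exact B.exists_hasSegreType_complex (hn (by simp)) hc

end SemiNullBasis

end SegreOfCanonical

end SegreClassification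

theorem mainTheorem3 {V : Type*} [AddCommGroup V] [Module ℝ V] [FiniteDimensional ℝ V]
    (n : ℕ) (hn : 5 ≤ n) (g : LinearMap.BilinForm ℝ V)
    (hg : SegreClassification.IsLorentzian n g)
    (R : LinearMap.BilinForm ℝ V) (hR : R.IsSymm) :
    (∃ (v : V) (η : ℝ), 0 < g v v ∧
      Module.End.HasEigenvector (SegreClassification.mixed g hg.nondegenerate R) η v) ∧
    (∃ (σ : SegreClassification.SegreType) (c : SegreClassification.SegreClass),
      SegreClassification.HasSegreType g (SegreClassification.mixed g hg.nondegenerate R) σ ∧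
      SegreClassification.IsDegeneracyOf σ (c.entries n)) ∧
    (∀ c : SegreClassification.SegreClass,
      (∃ σ : SegreClassification.SegreType,
        SegreClassification.HasSegreType g (SegreClassification.mixed g hg.nondegenerate R) σ ∧
        SegreClassification.IsDegeneracyOf σ (c.entries n)) ↔
      ∃ B : SegreClassification.SemiNullBasis g (n - 2),
        SegreClassification.CanonicalForm B R c) := by
  obtain ⟨k, rfl⟩ : ∃ k, n = k + 3 := ⟨n - 3, by omega⟩
  change _ ∧ _ ∧ ∀ c : SegreClassification.SegreClass, _ ↔
    ∃ B : SegreClassification.SemiNullBasis g (k + 1), SegreClassification.CanonicalForm B R c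
  have hs := hg.apply_comm
  have hp := hg.posOnHyperplane (by omega)
  have hT := SegreClassification.mixed_selfAdjoint hg.nondegenerate hs hR
  obtain ⟨c, B, hB⟩ := SegreClassification.exists_canonicalAction hg.nondegenerate hs hp
    (hg.exists_timelike (by omega)) hT hg.finrank
  obtain ⟨σ, hσ, hσc⟩ := B.exists_hasSegreType hs hp hT hB
  refine ⟨?_, ⟨σ, c, hσ, hσc⟩, fun c' => ⟨?_, ?_⟩⟩
  -- Index `1` stands for `x⁽²⁾`, which exists since `n ≥ 4`.
  · have hx : g (B.x ⟨1, by omega⟩) (B.x ⟨1, by omega⟩) = 1 := by rw [B.x_x, if_pos rfl]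
    obtain ⟨η, hη⟩ := B.apply_x_of_canonicalAction hB ⟨1, by omega⟩ one_ne_zero
    refine ⟨_, η, by rw [hx]; exact one_pos, Module.End.mem_eigenspace_iff.2 hη, fun h => ?_⟩
    simp [h] at hx
  · rintro ⟨σ', hσ', hσc'⟩
    obtain rfl := SegreClassification.SegreClass.eq_of_hasSegreType hσ' hσc' hσ hσc
    exact ⟨B, (B.canonicalForm_iff hg.nondegenerate R _).2 hB⟩
  · rintro ⟨B', hB'⟩
    exact B'.exists_hasSegreType hs hp hT ((B'.canonicalForm_iff hg.nondegenerate R _).1 hB')
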